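/- **Setting.** Let $1\le M\le N$. Consider a network of $N$ nodes with matrices $A,G\in\mathbb R^{n\times n}$, $C\in\mathbb R^{p\times n}$, noise covariances $Q_i>0$, $R_i>0$, links $a_{ij}\in\{0,1\}$ with $a_{ii}=0$, coupling parameter $\mu\ge 0$, packet arrival probability $\lambda\in[0,1]$ and scheduling price $\kappa>0$. Put $\tilde A=\sqrt{1+\mu}\,A$, $\tilde G=\sqrt{\mu+\mu^2}\,G$, $\mathcal N_i=\{j: a_{ij}=1\}$, $d_i=|\mathcal N_i|$, $d_m=\max_i d_i$ and $$h_i(Y)=\tilde A Y_i\tilde A^T+d_i\sum_{j\in\mathcal N_i}\tilde G Y_j\tilde G^T+Q_i .$$ Let $P_1,\dots,P_N\ge 0$ be a steady state of the distributed filter: $P_i=\big(h_i(P)^{-1}+C^TR_i^{-1}C\big)^{-1}$ for all $i$. The sensor-scheduling MDP has state space $\mathcal S=\mathbb Z_+^N$ (positive integers), where the entry $s_i$ is the time since the last packet received by node $i$ was sent. Its set of admissible actions is any $\mathcal A\subseteq\{0,1\}^N$ that contains all $a$ with $\sum_i a_i=M$ (so $\mathcal A=\{0,1\}^N$ and $\mathcal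 A=\{a:\sum_i a_i=M\}$ are both allowed). The transition kernel is $\mathcal P(s^+|s,a)=\prod_i \Pr(s_i^+|s_i,a_i)$, where under $a_i=1$ the entry $s_i$ moves to $1$ with probability $\lambda$ and to $s_i+1$ with probability $1-\lambda$, and under $a_i=0$ it moves to $s_i+1$. The one-stage cost is $$c(s,a)=\sum_{i=1}^N\big(\mathrm{Tr}\,h_i(Y_{-1})+\kappa a_i\big),$$ where, with the current time taken as $0$, $Y_{l,i}=P_i$ if $l\le -s_i$ and $Y_{l,i}=h_i(Y_{l-1})$ if $-s_i<l<0$. A policy $\pi=(\pi_k)_{k\ge0}$ chooses $a_k=\pi_k(s_0,\dots,s_k,a_0,\dots,a_{k-1})\in\mathcal A$, and $$J(s_0,\pi)=\limsup_{T\to\infty}\frac1T\,\mathbb E^\pi_{s_0}\Big[\sum_{k=1}^T c(s_k,a_k)\Big]\in[0,\infty].$$ **Theorem.** Let $r=\lceil N/M\rceil$ and suppose that $(1-\lambda)\rho(U)^{2r}<1$ for any matrix $U\in\mathbb R^{n\times n}$ with $U^TU=\tilde A^T\tilde A+d_m^2\tilde G^T\tilde G$, where $\rho$ denotes the spectral radius.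 Then there are a deterministic stationary policy $\pi^*:\mathcal S\to\mathcal A$, a constant $J^*\in\mathbb R$ and a function $V:\mathcal S\to\mathbb R$ such that for all $s\in\mathcal S$ $$J^*+V(s)=\min_{a\in\mathcal A}\Big[c(s,a)+\sum_{s^+\in\mathcal S}V(s^+)\mathcal P(s^+|s,a)\Big]=c(s,\pi^*(s))+\sum_{s^+\in\mathcal S}V(s^+)\mathcal P(s^+|s,\pi^*(s)).$$ Moreover, for every initial state $s_0\in\mathcal S$, $J^*=J(s_0,\pi^*)=\min_\pi J(s_0,\pi)$, the minimum being over all policies. -/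

import Mathlib

/-- The data of a network of `N` coupled linear subsystems with state dimension `n` and
measurement dimension `p`, observed by one sensor per node, together with the packet arrival
rate `lam` and the price `κ` of one scheduling operation. -/
structure Network (N n p : ℕ) where
  /-- system matrix -/
  A : Matrix (Fin n) (Fin n) ℝ
  /-- inner coupling matrix -/
  G : Matrix (Fin n) (Fin n) ℝ
  /-- measurement matrix -/
  C : Matrix (Fin p) (Fin n) ℝ
  /-- process noise covariances -/
  Q : Fin N → Matrix (Fin n) (Fin n) ℝ
  /-- measurement noise covariances -/
  R : Fin N → Matrix (Fin p) (Fin p) ℝ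
  /-- `adj i j` says that node `i` receives information from node `j` -/
  adj : Fin N → Fin N → Bool
  /-- coupling parameter -/
  μ : ℝ
  /-- probability that a transmitted packet arrives -/
  lam : ℝ
  /-- cost of one scheduling operation -/
  κ : ℝ
  Q_posDef : ∀ i, (Q i).PosDef
  R_posDef : ∀ i, (R i).PosDef
  no_self_loop : ∀ i, adj i i = false
  μ_nonneg : 0 ≤ μ
  lam_nonneg : 0 ≤ lam
  lam_le_one : lam ≤ 1
  κ_pos : 0 < κ

/-- A state: `s i` is the time elapsed since the last packet received by node `i` was sent. -/
abbrev NodeState (N : ℕ) : Type := Fin N → ℕ+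

/-- An action: `a i` says whether sensor `i` is asked to transmit. -/
abbrev SchedAction (N : ℕ) : Type := Fin N → Bool

/-- The number of sensors that are scheduled by `a`. -/
def numScheduled {N : ℕ} (a : SchedAction N) : ℕ :=
  (Finset.univ.filter fun i => a i = true).card

/-- The spectral radius of a real square matrix: the largest modulus of its complex
eigenvalues. -/
noncomputable def realSpectralRadius {n : ℕ} (U : Matrix (Fin n) (Fin n) ℝ) : ℝ :=
  (spectralRadius ℂ (U.map ((↑) : ℝ → ℂ))).toReal

namespace Network

variable {N n p : ℕ} (net : Network N n p)

/-- `Ã = √(1 + μ) A`. -/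
noncomputable def tildeA : Matrix (Fin n) (Fin n) ℝ := Real.sqrt (1 + net.μ) • net.A

/-- `G̃ = √(μ + μ²) G`. -/
noncomputable def tildeG : Matrix (Fin n) (Fin n) ℝ := Real.sqrt (net.μ + net.μ ^ 2) • net.G

/-- The set of neighbours of node `i`. -/
def nbrs (i : Fin N) : Finset (Fin N) := Finset.univ.filter fun j => net.adj i j = true

/-- The number of neighbours of node `i`. -/
def deg (i : Fin N) : ℕ := (net.nbrs i).card

/-- The largest number of neighbours of a node. -/
def maxDeg : ℕ := Finset.univ.sup net.deg

/-- One prediction step for node `i`: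
`h_i(Y) = Ã Y_i Ãᵀ + d_i ∑_{j ∈ 𝒩_i} G̃ Y_j G̃ᵀ + Q_i`. -/
noncomputable def predict (i : Fin N) (Y : Fin N → Matrix (Fin n) (Fin n) ℝ) :
    Matrix (Fin n) (Fin n) ℝ :=
  net.tildeA * Y i * net.tildeA.transpose
    + (net.deg i : ℝ) • ∑ j ∈ net.nbrs i, net.tildeG * Y j * net.tildeG.transpose
    + net.Q i

/-- `P` is a steady state of the performance indices of the distributed filter run by the
sensors: `P_i = (P̆_i⁻¹ + Cᵀ R_i⁻¹ C)⁻¹` with `P̆_i = h_i(P)`. -/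
def IsSteadyState (P : Fin N → Matrix (Fin n) (Fin n) ℝ) : Prop :=
  ∀ i, (P i).PosSemidef ∧
    P i = ((net.predict i P)⁻¹ + net.C.transpose * (net.R i)⁻¹ * net.C)⁻¹

/-- `(1 - λ) ρ(U)^{2r} < 1`, with `r = ⌈N / M⌉`, for any matrix `U` such that
`Uᵀ U = Ãᵀ Ã + d_m² G̃ᵀ G̃`. -/
def FeasibilityCondition (M : ℕ) : Prop :=
  ∀ U : Matrix (Fin n) (Fin n) ℝ,
    U.transpose * U =
      net.tildeA.transpose * net.tildeA
        + (net.maxDeg : ℝ) ^ 2 • (net.tildeG.transpose * net.tildeG) →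
    (1 - net.lam) * realSpectralRadius U ^ (2 * ⌈(N : ℚ) / (M : ℚ)⌉₊) < 1

/-- The largest entry of a state. -/
def maxAge (s : NodeState N) : ℕ := Finset.univ.sup fun i => (s i : ℕ)

/-- The performance indices of the nodes, as recomputed at a time `k` at which the state is `s`.
With `m = maxAge s`, `updatedIndex P s t i` is the index `Y_{l,i}` at time `l = k - m + t`.
A packet carries all the past estimates of its sensor, so `Y_{l,i} = P_i` for all
`l ≤ k - s_i`, that is, for `t + s_i ≤ m`; at later times `Y_{l,i} = h_i(Y_{l-1})`. -/
noncomputable def updatedIndex (P : Fin N → Matrix (Fin n) (Fin n) ℝ) (s : NodeState N) :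
    ℕ → Fin N → Matrix (Fin n) (Fin n) ℝ
  | 0 => P
  | t + 1 => fun i =>
      if t + 1 + (s i : ℕ) ≤ maxAge s then P i else net.predict i (updatedIndex P s t)

/-- The one-stage cost `c(s, a) = ∑_i (Tr h_i(Y_{k-1}) + κ α_i)`. -/
noncomputable def cost (P : Fin N → Matrix (Fin n) (Fin n) ℝ) (s : NodeState N)
    (a : SchedAction N) : ℝ :=
  ∑ i, ((net.predict i (net.updatedIndex P s (maxAge s - 1))).trace
    + net.κ * (if a i then 1 else 0))

/-- The probability that the entry of node `i` moves from `τ` to `τ'` under the decision `α`. -/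
noncomputable def nodeTrans (τ' τ : ℕ+) (α : Bool) : ℝ :=
  if α = true then
    (if τ' = 1 then net.lam else if τ' = τ + 1 then 1 - net.lam else 0)
  else
    (if τ' = τ + 1 then 1 else 0)

/-- The transition kernel `𝒫(s' | s, a)`. -/
noncomputable def trans (s' s : NodeState N) (a : SchedAction N) : ℝ :=
  ∏ i, net.nodeTrans (s' i) (s i) (a i)

end Network

/-- A policy with admissible actions `𝒜`: at each time `k` it chooses the action `a_k` as a
function of `s_0, …, s_k` and `a_0, …, a_{k-1}`. -/
abbrev SchedPolicy {N : ℕ} (𝒜 : Set (SchedAction N)) : Type :=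
  (k : ℕ) → (Fin (k + 1) → NodeState N) → (Fin k → 𝒜) → 𝒜

/-- The deterministic stationary policy given by a function of the current state. -/
def stationaryPolicy {N : ℕ} {𝒜 : Set (SchedAction N)} (f : NodeState N → 𝒜) :
    SchedPolicy 𝒜 :=
  fun k s _ => f (s (Fin.last k))

namespace Network

variable {N n p : ℕ} (net : Network N n p)

/-- The expectation `𝔼^π_{s_0}[F(s_0, …, s_k, a_0, …, a_{k-1})]` of a function of the history
of the controlled process up to time `k`, as the iterated sum over the successive states. Each
sum over the next state has finitely many nonzero terms. -/
noncomputable def expectation {𝒜 : Set (SchedAction N)} (π : SchedPolicy 𝒜)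
    (s₀ : NodeState N) :
    (k : ℕ) → ((Fin (k + 1) → NodeState N) → (Fin k → 𝒜) → ℝ) → ℝ
  | 0, F => F (fun _ => s₀) Fin.elim0
  | k + 1, F => expectation π s₀ k fun s a =>
      ∑' s' : NodeState N, net.trans s' (s (Fin.last k)) (π k s a : SchedAction N) *
        F (Fin.snoc (α := fun _ => NodeState N) s s') (Fin.snoc (α := fun _ => 𝒜) a (π k s a))

/-- The expected average cost
`J(s_0, π) = limsup_{T → ∞} (1 / T) ∑_{k=1}^T 𝔼^π_{s_0}[c(s_k, a_k)]`, possibly infinite. -/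
noncomputable def avgCost (P : Fin N → Matrix (Fin n) (Fin n) ℝ) {𝒜 : Set (SchedAction N)}
    (s₀ : NodeState N) (π : SchedPolicy 𝒜) : EReal :=
  Filter.limsup
    (fun T : ℕ => (((1 / (T : ℝ)) * ∑ k ∈ Finset.Icc 1 T,
      net.expectation π s₀ k fun s a =>
        net.cost P (s (Fin.last k)) (π k s a : SchedAction N) : ℝ) : EReal))
    Filter.atTop

end Network

/-! The average cost problem is solved as a limit of discounted ones. Let `V_α` be the optimal
discounted cost. The stage cost is nonnegative and grows with the ages, hence so is `V_α`, and the
all-ones state minimises it. Suppose that `(1 - α) V_α(1)`, and `V_α(s) - V_α(1)` for each `s`, are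
bounded uniformly in `α` near one (`HasRelativeBound`). Then the discounted Bellman equations have a
limit `J + V = min (c + E V)` with `V ≥ 0` (`exists_acoe`). Following a minimiser, the costs
telescope, and `V ≥ 0` bounds their average by `J`. Conversely, a policy of average cost below `y`
has discounted cost at most `y / (1 - α) + B`, so `J ≤ y`; this Abelian argument needs no growth
condition on `V` (`exists_optimal_stationary`).

The uniform bounds for `λ > 0` come from the Lyapunov function `∑ γ ^ s_i` with `(1 - λ) γ ^ r < 1`,
which dominates the cost. A list of `r = ⌈N / M⌉` actions covers all nodes, and enough repetitions
of it contract this function up to a constant; this bounds `(1 - α) V_α`. For the relative values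
one needs a state `w`, reachable from everywhere, at which `V_α` exceeds `V_α(1)` by a bounded
amount. Take `N + 1` blocks of `r` optimal actions from the all-ones state, all packets arriving:
the value changes by a bounded amount. Some block schedules only nodes that are scheduled again
later. Replacing it, and all that precedes it, by covering lists erases the initial state and leads
to a state `w` below the original endpoint (`exists_dominating_block`). By monotonicity `V_α(w)` is
controlled, and `w` is hit with probability bounded below (`BlockData.valueIter_le_add`). For `λ =
0` the dynamics is deterministic, and the costs from two states differ by a summable sequence.

The exponential growth of the cost is governed by `boundMap`. In trace it expands by at most the
largest eigenvalue of `growthMatrix`, which is `ρ(U)²` for the symmetric square root `U`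
(`FeasibilityCondition.exists_rate`). -/

namespace Sched

variable {N : ℕ}

/-! ### The kernel as a finite average over the sets of arriving packets -/

/-- The state after one step in which exactly the packets marked by `b` arrive. -/
def next (s : NodeState N) (b : SchedAction N) : NodeState N :=
  fun i => if b i = true then 1 else s i + 1

/-- The probability that `β` tells whether the packet of a node with decision `α` arrives. -/
def arrivalProb (lam : ℝ) (α β : Bool) : ℝ :=
  if α = true then (if β = true then lam else 1 - lam) else (if β = true then 0 else 1)

/-- The probability that exactly the packets marked by `b` arrive under the action `a`. -/
def outcomeProb (lam : ℝ) (a b : SchedAction N) : ℝ :=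
  ∏ i, arrivalProb lam (a i) (b i)

/-- The mean of `f` over the next state. -/
def stepMean (lam : ℝ) (a : SchedAction N) (f : NodeState N → ℝ) (s : NodeState N) : ℝ :=
  ∑ b, outcomeProb lam a b * f (next s b)

lemma next_injective (s : NodeState N) : Function.Injective (next s) := by
  intro b b' h
  funext i
  have hi := congrFun h i
  have hne : (1 : ℕ+) ≠ s i + 1 := by
    intro h1
    have h2 := congrArg PNat.val h1
    have := (s i).pos
    simp at h2
  unfold next at hi
  cases hb : b i <;> cases hb' : b' i <;> simp only [hb, hb'] at hi ⊢
  · exact absurd hi.symm (by simpa using hne)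
  · exact absurd hi (by simpa using hne)

lemma next_mono {s t : NodeState N} (h : s ≤ t) (b : SchedAction N) : next s b ≤ next t b := by
  intro i
  unfold next
  split_ifs
  · exact le_rfl
  · exact add_le_add_left (h i) 1

lemma nodeTrans_next {n p : ℕ} (net : Network N n p) (s : NodeState N) (a b : SchedAction N)
    (i : Fin N) :
    net.nodeTrans (next s b i) (s i) (a i) = arrivalProb net.lam (a i) (b i) := by
  have hne : s i + 1 ≠ 1 := by
    intro h1
    have h2 := congrArg PNat.val h1
    simp at h2
  unfold Network.nodeTrans arrivalProb next
  cases b i <;> cases a i <;> simp [hne, hne.symm]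

lemma trans_next {n p : ℕ} (net : Network N n p) (s : NodeState N) (a b : SchedAction N) :
    net.trans (next s b) s a = outcomeProb net.lam a b :=
  Finset.prod_congr rfl fun i _ => nodeTrans_next net s a b i

lemma exists_next_of_trans_ne_zero {n p : ℕ} (net : Network N n p) {s s' : NodeState N}
    {a : SchedAction N} (h : net.trans s' s a ≠ 0) : ∃ b, next s b = s' := by
  have h1 : ∀ i, s' i = 1 ∨ s' i = s i + 1 := by
    intro i
    have hi := Finset.prod_ne_zero_iff.1 h i (Finset.mem_univ i)
    unfold Network.nodeTrans at hi
    by_contra hc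
    push Not at hc
    simp [hc.1, hc.2] at hi
  refine ⟨fun i => decide (s' i = 1), ?_⟩
  funext i
  unfold next
  rcases h1 i with h | h
  · simp [h]
  · by_cases h' : s' i = 1
    · simp [h']
    · simp only [h, decide_eq_true_eq, ite_eq_right_iff]
      intro h2
      exact absurd (h.trans h2) h'

/-- Every transition of nonzero probability is of the form `next s b`, and distinct `b` give
distinct states because `s i + 1 ≠ 1`. The series is therefore a sum of `2 ^ N` terms, and no
summability question arises later. -/
lemma tsum_trans_mul {n p : ℕ} (net : Network N n p) (s : NodeState N) (a : SchedAction N)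
    (f : NodeState N → ℝ) :
    ∑' s', net.trans s' s a * f s' = stepMean net.lam a f s := by
  rw [tsum_eq_sum (s := Finset.univ.map ⟨next s, next_injective s⟩)]
  · simp [stepMean, trans_next]
  · intro s' hs'
    by_contra hc
    obtain ⟨b, rfl⟩ := exists_next_of_trans_ne_zero net (left_ne_zero_of_mul hc)
    exact hs' (by simp)

lemma arrivalProb_nonneg {lam : ℝ} (h0 : 0 ≤ lam) (h1 : lam ≤ 1) (α β : Bool) :
    0 ≤ arrivalProb lam α β := by
  unfold arrivalProb
  split_ifs <;> linarith

lemma outcomeProb_nonneg {lam : ℝ} (h0 : 0 ≤ lam) (h1 : lam ≤ 1) (a b : SchedAction N) :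
    0 ≤ outcomeProb lam a b :=
  Finset.prod_nonneg fun _ _ => arrivalProb_nonneg h0 h1 _ _

/-- Arrivals are independent: the factors of the nodes other than `i` each sum to one. -/
lemma sum_outcomeProb_mul_apply (lam : ℝ) (a : SchedAction N) (i : Fin N) (φ : Bool → ℝ) :
    ∑ b, outcomeProb lam a b * φ (b i) = ∑ β, arrivalProb lam (a i) β * φ β := by
  have h1 : ∀ b : SchedAction N, outcomeProb lam a b * φ (b i)
      = ∏ j, arrivalProb lam (a j) (b j) * (if j = i then φ (b j) else 1) := by
    intro b
    rw [Finset.prod_mul_distrib, outcomeProb]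
    simp
  have h2 := Fintype.piFinset_univ (α := Fin N) (β := fun _ => Bool)
  simp_rw [h1]
  rw [← h2, ← Finset.prod_univ_sum (f := fun j β =>
    arrivalProb lam (a j) β * (if j = i then φ β else 1)), Finset.prod_eq_single i]
  · simp
  · intro j _ hj
    cases a j <;> simp [hj, arrivalProb]
  · simp

lemma sum_outcomeProb (lam : ℝ) (a : SchedAction N) : ∑ b, outcomeProb lam a b = 1 := by
  have h2 := Fintype.piFinset_univ (α := Fin N) (β := fun _ => Bool)
  unfold outcomeProb
  rw [← h2, ← Finset.prod_univ_sum]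
  refine Finset.prod_eq_one fun j _ => ?_
  cases a j <;> simp [arrivalProb]

lemma stepMean_mono {lam : ℝ} (h0 : 0 ≤ lam) (h1 : lam ≤ 1) (a : SchedAction N)
    {f g : NodeState N → ℝ} (h : ∀ s, f s ≤ g s) (s : NodeState N) :
    stepMean lam a f s ≤ stepMean lam a g s :=
  Finset.sum_le_sum fun _ _ =>
    mul_le_mul_of_nonneg_left (h _) (outcomeProb_nonneg h0 h1 _ _)

lemma stepMean_add (lam : ℝ) (a : SchedAction N) (f g : NodeState N → ℝ) (s : NodeState N) :
    stepMean lam a (fun s => f s + g s) s = stepMean lam a f s + stepMean lam a g s := by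
  simp [stepMean, mul_add, Finset.sum_add_distrib]

lemma stepMean_const_mul (lam : ℝ) (a : SchedAction N) (x : ℝ) (f : NodeState N → ℝ)
    (s : NodeState N) :
    stepMean lam a (fun s => x * f s) s = x * stepMean lam a f s := by
  simp only [stepMean, Finset.mul_sum]
  exact Finset.sum_congr rfl fun _ _ => by ring

lemma stepMean_const (lam : ℝ) (a : SchedAction N) (x : ℝ) (s : NodeState N) :
    stepMean lam a (fun _ => x) s = x := by
  simp [stepMean, ← Finset.sum_mul, sum_outcomeProb]

lemma stepMean_nonneg {lam : ℝ} (h0 : 0 ≤ lam) (h1 : lam ≤ 1) (a : SchedAction N)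
    {f : NodeState N → ℝ} (h : ∀ s, 0 ≤ f s) (s : NodeState N) : 0 ≤ stepMean lam a f s :=
  Finset.sum_nonneg fun _ _ => mul_nonneg (outcomeProb_nonneg h0 h1 _ _) (h _)

lemma stepMean_monotone {lam : ℝ} (h0 : 0 ≤ lam) (h1 : lam ≤ 1) (a : SchedAction N)
    {f : NodeState N → ℝ} (hf : Monotone f) : Monotone (stepMean lam a f) :=
  fun _ _ hst => Finset.sum_le_sum fun b _ =>
    mul_le_mul_of_nonneg_left (hf (next_mono hst b)) (outcomeProb_nonneg h0 h1 _ _)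

/-- Losing packets can only make the next state larger. -/
lemma apply_next_le_stepMean {lam : ℝ} (h0 : 0 ≤ lam) (h1 : lam ≤ 1) (a : SchedAction N)
    {f : NodeState N → ℝ} (hf : Monotone f) (s : NodeState N) :
    f (next s a) ≤ stepMean lam a f s := by
  rw [← stepMean_const lam a (f (next s a)) s]
  refine Finset.sum_le_sum fun b _ => ?_
  by_cases hb : ∀ i, b i = true → a i = true
  · refine mul_le_mul_of_nonneg_left (hf fun i => ?_) (outcomeProb_nonneg h0 h1 _ _)
    unfold next
    by_cases hbi : b i = true
    · simp [hbi, hb i hbi]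
    · by_cases hai : a i = true
      · simp [hai]
      · simp [hbi, hai]
  -- An outcome with an arrival that was not requested has probability zero.
  · push Not at hb
    obtain ⟨i, hbi, hai⟩ := hb
    have : outcomeProb lam a b = 0 :=
      Finset.prod_eq_zero (Finset.mem_univ i) (by simp [arrivalProb, hbi, hai])
    simp [this]

/-- The event that all requested packets arrive has probability at least `lam ^ N`. -/
lemma pow_mul_apply_next_le_stepMean {lam : ℝ} (h0 : 0 ≤ lam) (h1 : lam ≤ 1)
    (a : SchedAction N) {f : NodeState N → ℝ} (hf : ∀ s, 0 ≤ f s) (s : NodeState N) :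
    lam ^ N * f (next s a) ≤ stepMean lam a f s := by
  have hp : lam ^ N ≤ outcomeProb lam a a := by
    have : lam ^ N = ∏ _i : Fin N, lam := by simp
    rw [this]
    refine Finset.prod_le_prod (fun _ _ => h0) fun i _ => ?_
    cases a i <;> simp [arrivalProb, h1]
  calc lam ^ N * f (next s a) ≤ outcomeProb lam a a * f (next s a) :=
        mul_le_mul_of_nonneg_right hp (hf _)
    _ ≤ stepMean lam a f s :=
        Finset.single_le_sum (f := fun b => outcomeProb lam a b * f (next s b))
          (fun b _ => mul_nonneg (outcomeProb_nonneg h0 h1 _ _) (hf _)) (Finset.mem_univ a)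

lemma stepMean_apply (lam : ℝ) (a : SchedAction N) (i : Fin N) (φ : ℕ+ → ℝ)
    (s : NodeState N) :
    stepMean lam a (fun s => φ (s i)) s =
      if a i = true then lam * φ 1 + (1 - lam) * φ (s i + 1) else φ (s i + 1) := by
  have := sum_outcomeProb_mul_apply lam a i fun β => φ (if β = true then 1 else s i + 1)
  simp only [stepMean, next]
  rw [this]
  cases a i <;> simp [arrivalProb]

lemma stepMean_zero (a : SchedAction N) (f : NodeState N → ℝ) (s : NodeState N) :
    stepMean 0 a f s = f (next s fun _ => false) := by
  unfold stepMean
  rw [Finset.sum_eq_single fun _ => false]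
  · have : outcomeProb 0 a (fun _ => false) = 1 :=
      Finset.prod_eq_one fun i _ => by cases a i <;> simp [arrivalProb]
    rw [this, one_mul]
  · intro b _ hb
    obtain ⟨i, hi⟩ := Function.ne_iff.1 hb
    have : outcomeProb 0 a b = 0 :=
      Finset.prod_eq_zero (Finset.mem_univ i) (by
        simp only [ne_eq, Bool.not_eq_false] at hi
        simp [arrivalProb, hi])
    simp [this]
  · simp

/-! ### Sequences of actions -/

/-- The mean of `f` over the state reached by a sequence of actions. -/
def iterMean (lam : ℝ) : List (SchedAction N) → (NodeState N → ℝ) → NodeState N → ℝ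
  | [], f => f
  | a :: l, f => stepMean lam a (iterMean lam l f)

/-- The state reached by a sequence of actions when all packets arrive. -/
def iterNext (s : NodeState N) : List (SchedAction N) → NodeState N
  | [] => s
  | a :: l => iterNext (next s a) l

lemma iterMean_mono {lam : ℝ} (h0 : 0 ≤ lam) (h1 : lam ≤ 1) (l : List (SchedAction N))
    {f g : NodeState N → ℝ} (h : ∀ s, f s ≤ g s) (s : NodeState N) :
    iterMean lam l f s ≤ iterMean lam l g s := by
  induction l generalizing s with
  | nil => exact h s
  | cons a l ih => exact stepMean_mono h0 h1 a ih s

lemma iterMean_add (lam : ℝ) (l : List (SchedAction N)) (f g : NodeState N → ℝ)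
    (s : NodeState N) :
    iterMean lam l (fun s => f s + g s) s = iterMean lam l f s + iterMean lam l g s := by
  induction l generalizing s with
  | nil => rfl
  | cons a l ih =>
    simp only [iterMean]
    rw [← stepMean_add, funext ih]

lemma iterMean_const_mul (lam : ℝ) (l : List (SchedAction N)) (x : ℝ) (f : NodeState N → ℝ)
    (s : NodeState N) :
    iterMean lam l (fun s => x * f s) s = x * iterMean lam l f s := by
  induction l generalizing s with
  | nil => rfl
  | cons a l ih =>
    simp only [iterMean]
    rw [← stepMean_const_mul, funext ih]

lemma iterMean_const (lam : ℝ) (l : List (SchedAction N)) (x : ℝ) (s : NodeState N) :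
    iterMean lam l (fun _ => x) s = x := by
  induction l generalizing s with
  | nil => rfl
  | cons a l ih =>
    simp only [iterMean]
    rw [funext ih, stepMean_const]

lemma iterMean_sum (lam : ℝ) (l : List (SchedAction N)) {ι : Type*} (t : Finset ι)
    (f : ι → NodeState N → ℝ) (s : NodeState N) :
    iterMean lam l (fun s => ∑ i ∈ t, f i s) s = ∑ i ∈ t, iterMean lam l (f i) s := by
  classical
  induction t using Finset.induction_on with
  | empty => simpa using iterMean_const lam l 0 s
  | insert i t hi ih =>
    simp only [Finset.sum_insert hi]
    rw [iterMean_add, ih]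

lemma pow_mul_apply_iterNext_le_iterMean {lam : ℝ} (h0 : 0 ≤ lam) (h1 : lam ≤ 1)
    (l : List (SchedAction N)) {f : NodeState N → ℝ} (hf : ∀ s, 0 ≤ f s) (s : NodeState N) :
    (lam ^ N) ^ l.length * f (iterNext s l) ≤ iterMean lam l f s := by
  induction l generalizing s with
  | nil => simp [iterMean, iterNext]
  | cons a l ih =>
    have hl : ∀ s, 0 ≤ iterMean lam l f s := fun s => by
      simpa [iterMean_const] using iterMean_mono h0 h1 l (f := fun _ => 0) hf s
    calc (lam ^ N) ^ (a :: l).length * f (iterNext s (a :: l))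
        = lam ^ N * ((lam ^ N) ^ l.length * f (iterNext (next s a) l)) := by
          simp [iterNext, pow_succ]; ring
      _ ≤ lam ^ N * iterMean lam l f (next s a) :=
          mul_le_mul_of_nonneg_left (ih _) (pow_nonneg h0 N)
      _ ≤ _ := pow_mul_apply_next_le_stepMean h0 h1 a hl s

/-- Each transmission of node `i` damps the exponential moment of its age. -/
lemma iterMean_pow_le {lam γ : ℝ} (h0 : 0 ≤ lam) (h1 : lam ≤ 1) (hγ : 1 ≤ γ)
    (l : List (SchedAction N)) (i : Fin N) (s : NodeState N) :
    iterMean lam l (fun s => γ ^ (s i : ℕ)) s ≤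
      (1 - lam) ^ l.countP (fun a => a i) * γ ^ l.length * γ ^ (s i : ℕ)
        + l.length * γ ^ l.length := by
  induction l generalizing s with
  | nil => simp [iterMean]
  | cons a l ih =>
    set q := (1 - lam) ^ l.countP (fun a => a i) with hq
    have hq0 : 0 ≤ q := pow_nonneg (by linarith) _
    have hq1 : q ≤ 1 := pow_le_one₀ (by linarith) (by linarith)
    have hg0 : (0 : ℝ) ≤ γ ^ l.length := by positivity
    have hg1 : γ ^ l.length ≤ γ ^ (l.length + 1) := pow_le_pow_right₀ hγ (by omega)
    -- The induction hypothesis is affine in `γ ^ s i`, so averaging it over the first step only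
    -- needs the one-step mean of that power.
    have key : iterMean lam (a :: l) (fun s => γ ^ (s i : ℕ)) s ≤
        q * γ ^ l.length * (if a i = true then lam * γ + (1 - lam) * γ ^ ((s i : ℕ) + 1)
          else γ ^ ((s i : ℕ) + 1)) + l.length * γ ^ l.length := by
      refine (stepMean_mono h0 h1 a ih s).trans (le_of_eq ?_)
      rw [stepMean_add, stepMean_const, stepMean_const_mul,
        stepMean_apply lam a i (fun x => γ ^ (x : ℕ))]
      simp
    refine key.trans ?_
    have hlen : (0 : ℝ) ≤ l.length := by positivity
    have e1 : (l.length : ℝ) * γ ^ l.length ≤ l.length * γ ^ (l.length + 1) :=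
      mul_le_mul_of_nonneg_left hg1 hlen
    have e2 : (0 : ℝ) ≤ γ ^ (l.length + 1) := by positivity
    by_cases ha : a i = true
    · have e3 : q * lam * γ ^ (l.length + 1) ≤ γ ^ (l.length + 1) :=
        mul_le_of_le_one_left e2 (mul_le_one₀ hq1 h0 h1)
      simp only [ha, if_true, List.countP_cons, List.length_cons]
      push_cast
      rw [pow_succ (1 - lam), ← hq]
      have e4 : q * γ ^ l.length * (lam * γ + (1 - lam) * γ ^ ((s i : ℕ) + 1))
          = q * lam * γ ^ (l.length + 1)
            + q * (1 - lam) * γ ^ (l.length + 1) * γ ^ (s i : ℕ) := by ring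
      rw [e4]
      linarith
    · simp only [ha, List.countP_cons, List.length_cons]
      push_cast
      have e4 : q * γ ^ l.length * γ ^ ((s i : ℕ) + 1)
          = q * γ ^ (l.length + 1) * γ ^ (s i : ℕ) := by ring
      simp only [add_zero]
      rw [← hq, e4]
      linarith

lemma iterNext_append (s : NodeState N) (l l' : List (SchedAction N)) :
    iterNext s (l ++ l') = iterNext (iterNext s l) l' := by
  induction l generalizing s with
  | nil => rfl
  | cons a l ih => exact ih _

lemma iterNext_apply_of_forall {l : List (SchedAction N)} {i : Fin N}
    (h : ∀ a ∈ l, a i = false) (s : NodeState N) :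
    (iterNext s l i : ℕ) = s i + l.length := by
  induction l generalizing s with
  | nil => simp [iterNext]
  | cons a l ih =>
    rw [iterNext, ih fun b hb => h b (List.mem_cons_of_mem _ hb)]
    simp [next, h a]
    ring

lemma iterNext_apply_congr {l : List (SchedAction N)} {i : Fin N} {s t : NodeState N}
    (h : s i = t i) : iterNext s l i = iterNext t l i := by
  induction l generalizing s t with
  | nil => exact h
  | cons a l ih =>
    have h1 : next s a i = next t a i := by simp only [next, h]
    exact ih h1

/-- A successful request resets the entry to one, after which the starting state plays no role. -/
lemma iterNext_apply_eq {l : List (SchedAction N)} {i : Fin N}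
    (h : ∃ a ∈ l, a i = true) (s t : NodeState N) :
    iterNext s l i = iterNext t l i := by
  induction l generalizing s t with
  | nil => simp at h
  | cons a l ih =>
    by_cases ha : a i = true
    · have h1 : next s a i = next t a i := by simp only [next, ha, if_true]
      exact iterNext_apply_congr (l := l) h1
    · refine ih ?_ _ _
      obtain ⟨b, hb, hbi⟩ := h
      rcases List.mem_cons.1 hb with rfl | hb
      · exact absurd hbi ha
      · exact ⟨b, hb, hbi⟩

lemma iterNext_apply_le (l : List (SchedAction N)) (i : Fin N) (s : NodeState N) :
    (iterNext s l i : ℕ) ≤ s i + l.length := by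
  induction l generalizing s with
  | nil => simp [iterNext]
  | cons a l ih =>
    refine (ih _).trans ?_
    have := (s i).pos
    unfold next
    split_ifs <;> simp <;> omega

lemma iterNext_apply_le_length {l : List (SchedAction N)} {i : Fin N}
    (h : ∃ a ∈ l, a i = true) (s : NodeState N) : (iterNext s l i : ℕ) ≤ l.length := by
  induction l generalizing s with
  | nil => simp at h
  | cons a l ih =>
    by_cases ha : a i = true
    · refine (iterNext_apply_le l i _).trans ?_
      simp [next, ha]
      omega
    · obtain ⟨b, hb, hbi⟩ := h
      rcases List.mem_cons.1 hb with rfl | hb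
      · exact absurd hbi ha
      · exact (ih ⟨b, hb, hbi⟩ _).trans (by simp)

end Sched

open Filter Topology

namespace Sched

variable {N : ℕ}

/-! ### Discounted value iteration -/

/-- The optimal `α`-discounted cost over `n` steps. -/
noncomputable def valueIter (lam : ℝ) (c : NodeState N → SchedAction N → ℝ)
    (𝒜 : Set (SchedAction N)) (α : ℝ) : ℕ → NodeState N → ℝ
  | 0 => fun _ => 0
  | n + 1 => fun s => ⨅ a : 𝒜, (c s a + α * stepMean lam a (valueIter lam c 𝒜 α n) s)

/-- The optimal `α`-discounted cost. -/
noncomputable def discValue (lam : ℝ) (c : NodeState N → SchedAction N → ℝ)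
    (𝒜 : Set (SchedAction N)) (α : ℝ) (s : NodeState N) : ℝ :=
  ⨆ n, valueIter lam c 𝒜 α n s

/-- The data of the scheduling problem: an arrival probability and a non-negative one-stage cost
that is monotone in the state. -/
structure IsMonotoneCost (lam : ℝ) (c : NodeState N → SchedAction N → ℝ) : Prop where
  lam_nonneg : 0 ≤ lam
  lam_le_one : lam ≤ 1
  nonneg : ∀ s a, 0 ≤ c s a
  mono : ∀ a, Monotone fun s => c s a

variable {lam : ℝ} {c : NodeState N → SchedAction N → ℝ} {𝒜 : Set (SchedAction N)} {α : ℝ}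

lemma valueIter_succ_le {a : SchedAction N} (ha : a ∈ 𝒜) (n : ℕ) (s : NodeState N) :
    valueIter lam c 𝒜 α (n + 1) s ≤ c s a + α * stepMean lam a (valueIter lam c 𝒜 α n) s :=
  ciInf_le (f := fun a : 𝒜 => c s a + α * stepMean lam a (valueIter lam c 𝒜 α n) s)
    (Set.finite_range _).bddBelow ⟨a, ha⟩

lemma exists_valueIter_succ_eq (h𝒜 : 𝒜.Nonempty) (n : ℕ) (s : NodeState N) :
    ∃ a ∈ 𝒜, valueIter lam c 𝒜 α (n + 1) s
      = c s a + α * stepMean lam a (valueIter lam c 𝒜 α n) s := by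
  have := h𝒜.to_subtype
  obtain ⟨a, ha⟩ := exists_eq_ciInf_of_finite
    (f := fun a : 𝒜 => c s a + α * stepMean lam a (valueIter lam c 𝒜 α n) s)
  exact ⟨a, a.2, ha.symm⟩

lemma valueIter_nonneg (hc : IsMonotoneCost lam c) (h𝒜 : 𝒜.Nonempty) (hα : 0 ≤ α) (n : ℕ)
    (s : NodeState N) : 0 ≤ valueIter lam c 𝒜 α n s := by
  induction n generalizing s with
  | zero => exact le_rfl
  | succ n ih =>
    obtain ⟨a, -, ha⟩ := exists_valueIter_succ_eq (lam := lam) (c := c) (α := α) h𝒜 n s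
    rw [ha]
    exact add_nonneg (hc.nonneg s a)
      (mul_nonneg hα (stepMean_nonneg hc.lam_nonneg hc.lam_le_one a ih s))

lemma valueIter_le_succ (hc : IsMonotoneCost lam c) (h𝒜 : 𝒜.Nonempty) (hα : 0 ≤ α) (n : ℕ)
    (s : NodeState N) : valueIter lam c 𝒜 α n s ≤ valueIter lam c 𝒜 α (n + 1) s := by
  induction n generalizing s with
  | zero => exact valueIter_nonneg hc h𝒜 hα 1 s
  | succ n ih =>
    obtain ⟨a, ha, ha'⟩ :=
      exists_valueIter_succ_eq (lam := lam) (c := c) (α := α) h𝒜 (n + 1) s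
    rw [ha']
    refine (valueIter_succ_le ha n s).trans ?_
    gcongr
    exact stepMean_mono hc.lam_nonneg hc.lam_le_one a ih s

lemma valueIter_monotone_nat (hc : IsMonotoneCost lam c) (h𝒜 : 𝒜.Nonempty) (hα : 0 ≤ α)
    (s : NodeState N) : Monotone fun n => valueIter lam c 𝒜 α n s :=
  monotone_nat_of_le_succ fun n => valueIter_le_succ hc h𝒜 hα n s

lemma valueIter_monotone (hc : IsMonotoneCost lam c) (h𝒜 : 𝒜.Nonempty) (hα : 0 ≤ α) (n : ℕ) :
    Monotone (valueIter lam c 𝒜 α n) := by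
  induction n with
  | zero => exact fun _ _ _ => le_rfl
  | succ n ih =>
    intro s t hst
    obtain ⟨a, ha, ha'⟩ := exists_valueIter_succ_eq (lam := lam) (c := c) (α := α) h𝒜 n t
    rw [ha']
    refine (valueIter_succ_le ha n s).trans ?_
    gcongr
    · exact hc.mono a hst
    · exact stepMean_monotone hc.lam_nonneg hc.lam_le_one a ih hst

/-- A real supremum over an unbounded range defaults to zero, so boundedness must accompany every
use of `discValue`. -/
lemma valueIter_le_discValue {s : NodeState N}
    (hb : BddAbove (Set.range fun n => valueIter lam c 𝒜 α n s)) (n : ℕ) :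
    valueIter lam c 𝒜 α n s ≤ discValue lam c 𝒜 α s :=
  le_ciSup hb n

lemma tendsto_valueIter (hc : IsMonotoneCost lam c) (h𝒜 : 𝒜.Nonempty) (hα : 0 ≤ α)
    {s : NodeState N} (hb : BddAbove (Set.range fun n => valueIter lam c 𝒜 α n s)) :
    Tendsto (fun n => valueIter lam c 𝒜 α n s) atTop (𝓝 (discValue lam c 𝒜 α s)) :=
  tendsto_atTop_ciSup (valueIter_monotone_nat hc h𝒜 hα s) hb

lemma discValue_monotone (hc : IsMonotoneCost lam c) (h𝒜 : 𝒜.Nonempty) (hα : 0 ≤ α)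
    (hb : ∀ s, BddAbove (Set.range fun n => valueIter lam c 𝒜 α n s)) :
    Monotone (discValue lam c 𝒜 α) := fun _ t hst =>
  ciSup_le fun n => (valueIter_monotone hc h𝒜 hα n hst).trans (valueIter_le_discValue (hb t) n)

lemma discValue_nonneg {s : NodeState N} (hb : BddAbove (Set.range fun n => valueIter lam c 𝒜 α n s)) :
    0 ≤ discValue lam c 𝒜 α s :=
  valueIter_le_discValue (n := 0) hb

lemma tendsto_stepMean {ι : Type*} {l : Filter ι} {f : ι → NodeState N → ℝ}
    {g : NodeState N → ℝ} (h : ∀ s, Tendsto (fun n => f n s) l (𝓝 (g s))) (a : SchedAction N)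
    (s : NodeState N) :
    Tendsto (fun n => stepMean lam a (f n) s) l (𝓝 (stepMean lam a g s)) :=
  tendsto_finsetSum _ fun _ _ => (h _).const_mul _

/-- A minimum over the finite set of actions passes to the limit. -/
lemma exists_limit_eq {ι : Type*} {l : Filter ι} [l.NeBot] {x : ι → ℝ} {x₀ : ℝ}
    {y : ι → SchedAction N → ℝ} {y₀ : SchedAction N → ℝ} (hx : Tendsto x l (𝓝 x₀))
    (hy : ∀ a, Tendsto (fun n => y n a) l (𝓝 (y₀ a)))
    (hle : ∀ᶠ n in l, ∀ a ∈ 𝒜, x n ≤ y n a) (hex : ∀ᶠ n in l, ∃ a ∈ 𝒜, y n a ≤ x n) :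
    (∀ a ∈ 𝒜, x₀ ≤ y₀ a) ∧ ∃ a ∈ 𝒜, x₀ = y₀ a := by
  have h1 : ∀ a ∈ 𝒜, x₀ ≤ y₀ a := fun a ha =>
    le_of_tendsto_of_tendsto hx (hy a) (hle.mono fun n hn => hn a ha)
  refine ⟨h1, ?_⟩
  by_contra hc
  push Not at hc
  -- There are finitely many actions, so the strict inequalities eventually hold simultaneously.
  have h2 : ∀ᶠ n in l, ∀ a, a ∈ 𝒜 → x n < y n a := by
    rw [eventually_all]
    intro a
    by_cases ha : a ∈ 𝒜
    · filter_upwards [hx.eventually_lt (hy a) (lt_of_le_of_ne (h1 a ha) (hc a ha))] with n hn _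
      exact hn
    · exact Eventually.of_forall fun n h => absurd h ha
  obtain ⟨n, hn1, a, ha, hn2⟩ := (h2.and hex).exists
  exact absurd hn2 (not_le.2 (hn1 a ha))

/-- The Bellman equation of the discounted problem. -/
lemma discValue_bellman (hc : IsMonotoneCost lam c) (h𝒜 : 𝒜.Nonempty) (hα : 0 ≤ α)
    (hb : ∀ s, BddAbove (Set.range fun n => valueIter lam c 𝒜 α n s)) (s : NodeState N) :
    (∀ a ∈ 𝒜, discValue lam c 𝒜 α s ≤ c s a + α * stepMean lam a (discValue lam c 𝒜 α) s) ∧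
    ∃ a ∈ 𝒜, discValue lam c 𝒜 α s
      = c s a + α * stepMean lam a (discValue lam c 𝒜 α) s := by
  have ht := fun s => tendsto_valueIter hc h𝒜 hα (hb s)
  refine exists_limit_eq (l := atTop) ((ht s).comp (tendsto_add_atTop_nat 1))
    (y := fun n a => c s a + α * stepMean lam a (valueIter lam c 𝒜 α n) s)
    (fun a => ((tendsto_stepMean ht a s).const_mul α).const_add _)
    (Eventually.of_forall fun n a ha => valueIter_succ_le ha n s)
    (Eventually.of_forall fun n => ?_)
  obtain ⟨a, ha, h⟩ := exists_valueIter_succ_eq (lam := lam) (c := c) (α := α) h𝒜 n s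
  exact ⟨a, ha, h.ge⟩

/-- Along an optimal sequence of decisions with all packets arriving, the discounted value grows
at most geometrically. -/
lemma exists_list_pow_mul_discValue_le (hc : IsMonotoneCost lam c) (h𝒜 : 𝒜.Nonempty)
    (hα : 0 ≤ α) (hb : ∀ s, BddAbove (Set.range fun n => valueIter lam c 𝒜 α n s)) (H : ℕ)
    (s : NodeState N) :
    ∃ l : List (SchedAction N), l.length = H ∧ (∀ a ∈ l, a ∈ 𝒜) ∧
      α ^ H * discValue lam c 𝒜 α (iterNext s l) ≤ discValue lam c 𝒜 α s := by
  induction H generalizing s with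
  | zero => exact ⟨[], rfl, by simp, by simp [iterNext]⟩
  | succ H ih =>
    obtain ⟨a, ha, h⟩ := (discValue_bellman hc h𝒜 hα hb s).2
    obtain ⟨l, hl, hl𝒜, hle⟩ := ih (next s a)
    refine ⟨a :: l, by simp [hl], by simpa [ha] using hl𝒜, ?_⟩
    have h1 := apply_next_le_stepMean hc.lam_nonneg hc.lam_le_one a
      (discValue_monotone hc h𝒜 hα hb) s
    rw [h, iterNext, pow_succ']
    have h2 := mul_le_mul_of_nonneg_left (hle.trans h1) hα
    have h3 := hc.nonneg s a
    linarith

/-! ### The vanishing discount limit -/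

/-- The relative values of the discounted problems are bounded uniformly in the discount factor. -/
structure HasRelativeBound (lam : ℝ) (c : NodeState N → SchedAction N → ℝ)
    (𝒜 : Set (SchedAction N)) : Prop where
  bddAbove : ∀ α : ℝ, 1 / 2 ≤ α → α < 1 → ∀ s,
    BddAbove (Set.range fun n => valueIter lam c 𝒜 α n s)
  gain : ∃ B : ℝ, ∀ α : ℝ, 1 / 2 ≤ α → α < 1 → (1 - α) * discValue lam c 𝒜 α (fun _ => 1) ≤ B
  relative : ∃ W : NodeState N → ℝ, ∀ α : ℝ, 1 / 2 ≤ α → α < 1 → ∀ s,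
    discValue lam c 𝒜 α s ≤ discValue lam c 𝒜 α (fun _ => 1) + W s

lemma one_le_state (s : NodeState N) : (fun _ => 1 : NodeState N) ≤ s := fun _ => one_le

/-- A single ultrafilter makes all bounded sequences converge, so `J` and all values `V s` arise
along the same limit without a diagonal extraction. -/
lemma exists_tendsto_ultrafilter (F : Ultrafilter ℕ) {x : ℕ → ℝ} {B : ℝ}
    (h0 : ∀ n, 0 ≤ x n) (hB : ∀ n, x n ≤ B) : ∃ y, 0 ≤ y ∧ Tendsto x F (𝓝 y) := by
  obtain ⟨y, hy, hF⟩ := (isCompact_Icc (a := (0 : ℝ)) (b := B)).ultrafilter_le_nhds (F.map x)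
    (by
      rw [Ultrafilter.coe_map, le_principal_iff]
      exact Filter.mem_map.2 (Filter.univ_mem' fun n => ⟨h0 n, hB n⟩))
  exact ⟨y, hy.1, hF⟩

/-- The discount factors along which the vanishing discount limit is taken. -/
noncomputable def discSeq (j : ℕ) : ℝ := 1 - 1 / ((j : ℝ) + 2)

lemma half_le_discSeq (j : ℕ) : 1 / 2 ≤ discSeq j := by
  unfold discSeq
  have : (1 : ℝ) / ((j : ℝ) + 2) ≤ 1 / 2 := by
    apply one_div_le_one_div_of_le <;> linarith [(Nat.cast_nonneg j : (0 : ℝ) ≤ j)]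
  linarith

lemma discSeq_lt_one (j : ℕ) : discSeq j < 1 := by
  unfold discSeq
  have : (0 : ℝ) < 1 / ((j : ℝ) + 2) := by positivity
  linarith

lemma tendsto_discSeq : Tendsto discSeq atTop (𝓝 1) := by
  have h := (tendsto_one_div_add_atTop_nhds_zero_nat (𝕜 := ℝ)).comp (tendsto_add_atTop_nat 1)
  have h2 := h.const_sub 1
  rw [sub_zero] at h2
  refine h2.congr fun j => ?_
  simp only [Function.comp, discSeq]
  push_cast
  ring_nf

/-- The vanishing discount limit: a solution of the average cost optimality equation whose
constant is at most every upper bound of `(1 - α) V_α` near `α = 1`. -/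
theorem exists_acoe (hc : IsMonotoneCost lam c) (h𝒜 : 𝒜.Nonempty)
    (hR : HasRelativeBound lam c 𝒜) :
    ∃ (J : ℝ) (V : NodeState N → ℝ), (∀ s, 0 ≤ V s) ∧
      (∀ s, (∀ a ∈ 𝒜, J + V s ≤ c s a + stepMean lam a V s) ∧
        ∃ a ∈ 𝒜, J + V s = c s a + stepMean lam a V s) ∧
      ∀ (s : NodeState N) (x B : ℝ), (∀ α : ℝ, 1 / 2 ≤ α → α < 1 →
        (1 - α) * discValue lam c 𝒜 α s ≤ (1 - α) * B + x) → J ≤ x := by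
  obtain ⟨B, hB⟩ := hR.gain
  obtain ⟨W, hW⟩ := hR.relative
  set F : Ultrafilter ℕ := hyperfilter ℕ with hF
  have hFle : (F : Filter ℕ) ≤ atTop := by
    rw [← Nat.cofinite_eq_atTop]; exact hyperfilter_le_cofinite
  set D : ℕ → NodeState N → ℝ := fun j => discValue lam c 𝒜 (discSeq j) with hD
  have hα0 : ∀ j, 0 ≤ discSeq j := fun j => by linarith [half_le_discSeq j]
  have hbdd : ∀ j s, BddAbove (Set.range fun n => valueIter lam c 𝒜 (discSeq j) n s) :=
    fun j => hR.bddAbove _ (half_le_discSeq j) (discSeq_lt_one j)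
  have hmono : ∀ j, Monotone (D j) := fun j => discValue_monotone hc h𝒜 (hα0 j) (hbdd j)
  have hαF : Tendsto discSeq F (𝓝 1) := tendsto_discSeq.mono_left hFle
  obtain ⟨J, hJ0, hJ⟩ := exists_tendsto_ultrafilter F
    (x := fun j => (1 - discSeq j) * D j (fun _ => 1)) (B := B)
    (fun j => mul_nonneg (by linarith [discSeq_lt_one j])
      (discValue_nonneg (hbdd j _)))
    (fun j => hB _ (half_le_discSeq j) (discSeq_lt_one j))
  have hlim : ∀ s, ∃ y, 0 ≤ y ∧ Tendsto (fun j => D j s - D j (fun _ => 1)) F (𝓝 y) := fun s =>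
    exists_tendsto_ultrafilter F (B := W s)
      (fun j => sub_nonneg.2 (hmono j (one_le_state s)))
      (fun j => by linarith [hW _ (half_le_discSeq j) (discSeq_lt_one j) s])
  choose V hV0 hV using hlim
  refine ⟨J, V, hV0, fun s => ?_, fun s x B' hx => ?_⟩
  -- Subtracting `D j 1` inside the mean leaves `(1 - discSeq j) * D j 1` on the left-hand side of
  -- the Bellman equation, and this term tends to `J`.
  · refine exists_limit_eq (l := (F : Filter ℕ)) (hJ.add (hV s))
      (y := fun j a => c s a + discSeq j *
        stepMean lam a (fun s => D j s - D j (fun _ => 1)) s)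
      (fun a => by simpa using (hαF.mul (tendsto_stepMean hV a s)).const_add (c s a))
      (Eventually.of_forall fun j a ha => ?_) (Eventually.of_forall fun j => ?_)
    · have h := (discValue_bellman hc h𝒜 (hα0 j) (hbdd j) s).1 a ha
      have e := stepMean_add lam a (D j) (fun _ => - D j (fun _ => 1)) s
      simp only [← sub_eq_add_neg, stepMean_const] at e
      rw [e]
      change D j s ≤ c s a + discSeq j * stepMean lam a (D j) s at h
      linarith
    · obtain ⟨a, ha, h⟩ := (discValue_bellman hc h𝒜 (hα0 j) (hbdd j) s).2
      refine ⟨a, ha, ?_⟩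
      have e := stepMean_add lam a (D j) (fun _ => - D j (fun _ => 1)) s
      simp only [← sub_eq_add_neg, stepMean_const] at e
      rw [e]
      change D j s = c s a + discSeq j * stepMean lam a (D j) s at h
      linarith
  -- The all-ones state minimises `D j`, so a bound at `s` is a bound at ones; the term with `B'`
  -- vanishes in the limit.
  · have hr : Tendsto (fun j => (1 - discSeq j) * B' + x) F (𝓝 x) := by
      simpa using ((hαF.const_sub 1).mul_const B').add_const x
    refine le_of_tendsto_of_tendsto hJ hr (Eventually.of_forall fun j => ?_)
    refine le_trans ?_ (hx _ (half_le_discSeq j) (discSeq_lt_one j))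
    exact mul_le_mul_of_nonneg_left (hmono j (one_le_state s)) (by linarith [discSeq_lt_one j])

end Sched

namespace Sched

variable {N n p : ℕ}

/-! ### Expectations under a policy -/

section Expectation

variable (net : Network N n p) {𝒜 : Set (SchedAction N)} (π : SchedPolicy 𝒜) (s₀ : NodeState N)

lemma expectation_mono (k : ℕ) {F G : (Fin (k + 1) → NodeState N) → (Fin k → 𝒜) → ℝ}
    (h : ∀ s a, F s a ≤ G s a) :
    net.expectation π s₀ k F ≤ net.expectation π s₀ k G := by
  induction k with
  | zero => exact h _ _
  | succ k ih =>
    refine ih fun s a => ?_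
    rw [tsum_trans_mul net _ _ fun s' => F (Fin.snoc s s') (Fin.snoc a (π k s a)),
      tsum_trans_mul net _ _ fun s' => G (Fin.snoc s s') (Fin.snoc a (π k s a))]
    exact stepMean_mono net.lam_nonneg net.lam_le_one _ (fun _ => h _ _) _

lemma expectation_add (k : ℕ) (F G : (Fin (k + 1) → NodeState N) → (Fin k → 𝒜) → ℝ) :
    net.expectation π s₀ k (fun s a => F s a + G s a)
      = net.expectation π s₀ k F + net.expectation π s₀ k G := by
  induction k with
  | zero => rfl
  | succ k ih =>
    simp only [Network.expectation]
    rw [← ih]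
    congr 1
    funext s a
    rw [tsum_trans_mul net _ _ fun s' => F (Fin.snoc s s') (Fin.snoc a (π k s a)),
      tsum_trans_mul net _ _ fun s' => G (Fin.snoc s s') (Fin.snoc a (π k s a)),
      tsum_trans_mul net _ _ fun s' => F (Fin.snoc s s') (Fin.snoc a (π k s a))
        + G (Fin.snoc s s') (Fin.snoc a (π k s a)), stepMean_add]

lemma expectation_const_mul (k : ℕ) (x : ℝ)
    (F : (Fin (k + 1) → NodeState N) → (Fin k → 𝒜) → ℝ) :
    net.expectation π s₀ k (fun s a => x * F s a) = x * net.expectation π s₀ k F := by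
  induction k with
  | zero => rfl
  | succ k ih =>
    simp only [Network.expectation]
    rw [← ih]
    congr 1
    funext s a
    rw [tsum_trans_mul net _ _ fun s' => F (Fin.snoc s s') (Fin.snoc a (π k s a)),
      tsum_trans_mul net _ _ fun s' => x * F (Fin.snoc s s') (Fin.snoc a (π k s a)),
      stepMean_const_mul]

lemma expectation_const (k : ℕ) (x : ℝ) :
    net.expectation π s₀ k (fun _ _ => x) = x := by
  induction k with
  | zero => rfl
  | succ k ih =>
    simp only [Network.expectation]
    rw [← ih]
    congr 1
    funext s a
    rw [ih, tsum_trans_mul net _ _ fun _ => x, stepMean_const]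

/-- One more step of the process averages over the last transition. -/
lemma expectation_succ_last (k : ℕ) (f : NodeState N → ℝ) :
    net.expectation π s₀ (k + 1) (fun s _ => f (s (Fin.last (k + 1))))
      = net.expectation π s₀ k
          (fun s a => stepMean net.lam (π k s a : SchedAction N) f (s (Fin.last k))) := by
  simp only [Network.expectation]
  congr 1
  funext s a
  rw [← tsum_trans_mul]
  simp

variable (c : NodeState N → SchedAction N → ℝ)

/-- The expected cost at time `k` under a policy. -/
noncomputable def stageCost (k : ℕ) : ℝ :=
  net.expectation π s₀ k fun s a => c (s (Fin.last k)) (π k s a : SchedAction N)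

variable {net c}

lemma stageCost_nonneg (hc : IsMonotoneCost net.lam c) (k : ℕ) :
    0 ≤ stageCost net π s₀ c k := by
  rw [← expectation_const net π s₀ k 0]
  exact expectation_mono net π s₀ k fun s a => hc.nonneg _ _

/-- No policy has a smaller discounted cost than value iteration. -/
lemma valueIter_le_sum_stageCost {α : ℝ} (hα : 0 ≤ α) (m : ℕ) :
    valueIter net.lam c 𝒜 α m s₀ ≤ ∑ k ∈ Finset.range m, α ^ k * stageCost net π s₀ c k := by
  have key : ∀ k j, net.expectation π s₀ k
        (fun s _ => valueIter net.lam c 𝒜 α (j + 1) (s (Fin.last k)))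
      ≤ stageCost net π s₀ c k + α * net.expectation π s₀ (k + 1)
        (fun s _ => valueIter net.lam c 𝒜 α j (s (Fin.last (k + 1)))) := by
    intro k j
    rw [expectation_succ_last, ← expectation_const_mul, stageCost, ← expectation_add]
    exact expectation_mono net π s₀ k fun s a => valueIter_succ_le (π k s a).2 j _
  -- The starting time `k` is kept general for the induction on the horizon; the claim is the case
  -- `k = 0`.
  have h2 : ∀ k j, net.expectation π s₀ k
        (fun s _ => valueIter net.lam c 𝒜 α j (s (Fin.last k)))
      ≤ ∑ i ∈ Finset.range j, α ^ i * stageCost net π s₀ c (k + i) := by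
    intro k j
    induction j generalizing k with
    | zero => simp [valueIter, expectation_const]
    | succ j ih =>
      refine (key k j).trans ?_
      rw [Finset.sum_range_succ', add_comm]
      gcongr
      · refine (mul_le_mul_of_nonneg_left (ih (k + 1)) hα).trans (le_of_eq ?_)
        rw [Finset.mul_sum]
        refine Finset.sum_congr rfl fun i _ => ?_
        rw [pow_succ, show k + 1 + i = k + (i + 1) by ring]
        ring
      · simp
  simpa [Network.expectation] using h2 0 m

end Expectation

/-- An Abelian inequality: discounted sums are controlled by linear bounds on partial sums. -/
lemma sum_pow_mul_le_of_partial_sums {x : ℕ → ℝ} {J B α : ℝ} (hα : 0 ≤ α) (hα1 : α < 1)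
    (hJ : 0 ≤ J) (h : ∀ n, ∑ k ∈ Finset.range n, x k ≤ J * n + B) (n : ℕ) :
    ∑ k ∈ Finset.range n, α ^ k * x k ≤ J / (1 - α) + B := by
  have hS : ∀ n, ∑ k ∈ Finset.range n, (x k - J) ≤ B := fun n => by
    rw [Finset.sum_sub_distrib]
    have := h n
    simp only [Finset.sum_const, Finset.card_range, nsmul_eq_mul]
    linarith
  -- Abel summation as an invariant: the slack `B - S_n` is nonnegative, so lowering its weight from
  -- `α ^ n` to `α ^ (n + 1)` only weakens the bound.
  have key : ∀ n, ∑ k ∈ Finset.range n, α ^ k * (x k - J)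
      ≤ B - α ^ n * (B - ∑ k ∈ Finset.range n, (x k - J)) := by
    intro n
    induction n with
    | zero => simp
    | succ n ih =>
      rw [Finset.sum_range_succ]
      have h1 := hS (n + 1)
      rw [Finset.sum_range_succ] at h1 ⊢
      set S := ∑ k ∈ Finset.range n, (x k - J)
      have h2 : α ^ (n + 1) * (B - (S + (x n - J))) ≤ α ^ n * (B - (S + (x n - J))) :=
        mul_le_mul_of_nonneg_right (pow_le_pow_of_le_one hα hα1.le (by omega)) (by linarith)
      linarith
  have h3 : ∑ k ∈ Finset.range n, α ^ k * (x k - J) ≤ B := by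
    refine (key n).trans ?_
    have := mul_nonneg (pow_nonneg hα n) (sub_nonneg.2 (hS n))
    linarith
  have h4 : ∑ k ∈ Finset.range n, α ^ k ≤ 1 / (1 - α) := by
    have hpos : 0 < 1 - α := by linarith
    rw [le_div_iff₀ hpos]
    have := geom_sum_mul α n
    have h5 := pow_nonneg hα n
    nlinarith
  have h5 : ∑ k ∈ Finset.range n, α ^ k * x k
      = ∑ k ∈ Finset.range n, α ^ k * (x k - J) + J * ∑ k ∈ Finset.range n, α ^ k := by
    rw [Finset.mul_sum, ← Finset.sum_add_distrib]
    exact Finset.sum_congr rfl fun _ _ => by ring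
  have h6 := mul_le_mul_of_nonneg_left h4 hJ
  rw [h5]
  rw [mul_one_div] at h6
  linarith

/-- A real bound on the upper limit of averages gives a linear bound on the partial sums. -/
lemma exists_partial_sum_bound {x : ℕ → ℝ} {J : ℝ} (hx : ∀ k, 0 ≤ x k) (hJ : 0 ≤ J)
    (h : ∀ᶠ T : ℕ in atTop, (1 / (T : ℝ)) * ∑ k ∈ Finset.Icc 1 T, x k ≤ J) :
    ∃ B, ∀ n, ∑ k ∈ Finset.range n, x k ≤ J * n + B := by
  obtain ⟨T₀, hT₀⟩ := eventually_atTop.1 h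
  -- The sum up to `T₀` covers the times before the averages are controlled; the extra `x 0` is
  -- there because the averages start at `k = 1`.
  refine ⟨∑ k ∈ Finset.range (T₀ + 1), x k + x 0, fun n => ?_⟩
  by_cases hn : n ≤ T₀ + 1
  · have h1 : ∑ k ∈ Finset.range n, x k ≤ ∑ k ∈ Finset.range (T₀ + 1), x k :=
      Finset.sum_le_sum_of_subset_of_nonneg (Finset.range_mono hn) fun _ _ _ => hx _
    have := hx 0
    have : 0 ≤ J * n := by positivity
    linarith
  · obtain ⟨T, rfl⟩ : ∃ T, n = T + 1 := ⟨n - 1, by omega⟩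
    have h1 := hT₀ T (by omega)
    have hT : (0 : ℝ) < T := by
      have : 0 < T := by omega
      exact_mod_cast this
    rw [one_div, inv_mul_le_iff₀ hT] at h1
    have h2 : ∑ k ∈ Finset.range (T + 1), x k = x 0 + ∑ k ∈ Finset.Icc 1 T, x k := by
      rw [Finset.sum_range_succ', add_comm, Finset.range_eq_Ico, Finset.sum_Ico_add']
      rfl
    have h3 : 0 ≤ ∑ k ∈ Finset.range (T₀ + 1), x k := Finset.sum_nonneg fun _ _ => hx _
    rw [h2]
    push_cast
    nlinarith

/-- Average cost optimality: a uniform bound on the relative discounted values gives a solution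
of the average cost optimality equation and an optimal stationary policy. -/
theorem exists_optimal_stationary (net : Network N n p) (P : Fin N → Matrix (Fin n) (Fin n) ℝ)
    {𝒜 : Set (SchedAction N)} (h𝒜 : 𝒜.Nonempty) (hc : IsMonotoneCost net.lam (net.cost P))
    (hR : HasRelativeBound net.lam (net.cost P) 𝒜) :
    ∃ (πstar : NodeState N → 𝒜) (Jstar : ℝ) (V : NodeState N → ℝ),
      (∀ s : NodeState N,
        IsLeast
          (Set.range fun a : 𝒜 =>
            net.cost P s (a : SchedAction N)
              + ∑' s' : NodeState N, V s' * net.trans s' s (a : SchedAction N))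
          (Jstar + V s) ∧
        Jstar + V s =
          net.cost P s (πstar s : SchedAction N)
            + ∑' s' : NodeState N, V s' * net.trans s' s (πstar s : SchedAction N)) ∧
      (∀ s₀ : NodeState N,
        (Jstar : EReal) = net.avgCost P s₀ (stationaryPolicy πstar) ∧
        IsLeast (Set.range fun π : SchedPolicy 𝒜 => net.avgCost P s₀ π) (Jstar : EReal)) := by
  obtain ⟨J, V, hV0, hV, hJ⟩ := exists_acoe hc h𝒜 hR
  choose f hf𝒜 hf using fun s => (hV s).2
  set πs : NodeState N → 𝒜 := fun s => ⟨f s, hf𝒜 s⟩ with hπs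
  have hsum : ∀ s (a : SchedAction N),
      ∑' s' : NodeState N, V s' * net.trans s' s a = stepMean net.lam a V s := fun s a => by
    rw [← tsum_trans_mul]
    exact tsum_congr fun _ => mul_comm _ _
  have lower : ∀ (s₀ : NodeState N) (π : SchedPolicy 𝒜), (J : EReal) ≤ net.avgCost P s₀ π := by
    intro s₀ π
    by_contra hlt
    rw [not_le] at hlt
    -- A real number strictly between the average cost and `J` turns the extended-real inequality
    -- into an eventual bound on real averages.
    obtain ⟨y, hy1, hy2⟩ := EReal.lt_iff_exists_real_btwn.1 hlt
    have hev : ∀ᶠ T : ℕ in atTop, (1 / (T : ℝ)) *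
        ∑ k ∈ Finset.Icc 1 T, stageCost net π s₀ (net.cost P) k ≤ y := by
      filter_upwards [eventually_lt_of_limsup_lt hy1] with T hT
      exact (EReal.coe_lt_coe_iff.1 hT).le
    have hy0 : 0 ≤ y := by
      obtain ⟨T, hT⟩ := hev.exists
      exact le_trans (mul_nonneg (by positivity)
        (Finset.sum_nonneg fun k _ => stageCost_nonneg π s₀ hc k)) hT
    obtain ⟨B, hB⟩ := exists_partial_sum_bound (stageCost_nonneg π s₀ hc) hy0 hev
    have hJle : J ≤ y := by
      refine hJ s₀ _ B fun α hα hα1 => ?_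
      have hα0 : 0 ≤ α := by linarith
      have h1 : discValue net.lam (net.cost P) 𝒜 α s₀ ≤ y / (1 - α) + B :=
        ciSup_le fun m => (valueIter_le_sum_stageCost π s₀ hα0 m).trans
          (sum_pow_mul_le_of_partial_sums hα0 hα1 hy0 hB m)
      have hpos : 0 < 1 - α := by linarith
      have h2 := mul_le_mul_of_nonneg_left h1 hpos.le
      rw [mul_add, mul_div_cancel₀ _ hpos.ne'] at h2
      linarith
    exact absurd (EReal.coe_lt_coe_iff.1 hy2) (not_lt.2 hJle)
  have upper : ∀ s₀ : NodeState N, net.avgCost P s₀ (stationaryPolicy πs) ≤ (J : EReal) := by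
    intro s₀
    set π := stationaryPolicy πs with hπ
    set E : ℕ → ℝ := fun k => net.expectation π s₀ k fun s _ => V (s (Fin.last k)) with hE
    have hE0 : ∀ k, 0 ≤ E k := fun k => by
      rw [← expectation_const net π s₀ k 0]
      exact expectation_mono net π s₀ k fun s a => hV0 _
    -- Along the minimisers the optimality equation is an equality, so the costs telescope; the
    -- final `- E (T + 1)` is discarded because `V ≥ 0`.
    have hstep : ∀ k, stageCost net π s₀ (net.cost P) k = J + E k - E (k + 1) := by
      intro k
      have h1 : stageCost net π s₀ (net.cost P) k + E (k + 1) = J + E k := by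
        simp only [hE]
        rw [expectation_succ_last, stageCost, ← expectation_add,
          ← expectation_const net π s₀ k J, ← expectation_add]
        congr 1
        funext s a
        exact (hf (s (Fin.last k))).symm
      linarith
    have hsumT : ∀ T : ℕ, ∑ k ∈ Finset.Icc 1 T, stageCost net π s₀ (net.cost P) k
        = J * T + E 1 - E (T + 1) := by
      intro T
      induction T with
      | zero => simp
      | succ T ih =>
        rw [Finset.sum_Icc_succ_top (by omega), ih, hstep]
        push_cast
        ring
    have hle : ∀ᶠ T : ℕ in atTop, (((1 / (T : ℝ)) * ∑ k ∈ Finset.Icc 1 T,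
        stageCost net π s₀ (net.cost P) k : ℝ) : EReal) ≤ ((J + E 1 / T : ℝ) : EReal) := by
      filter_upwards [eventually_gt_atTop 0] with T hT
      have hT' : (0 : ℝ) < T := by exact_mod_cast hT
      rw [EReal.coe_le_coe_iff, hsumT]
      have := hE0 (T + 1)
      rw [one_div, inv_mul_le_iff₀ hT', mul_add, mul_div_cancel₀ _ hT'.ne']
      linarith
    have hlim : Tendsto (fun T : ℕ => ((J + E 1 / T : ℝ) : EReal)) atTop (𝓝 (J : EReal)) := by
      refine (continuous_coe_real_ereal.tendsto J).comp ?_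
      simpa using (tendsto_const_div_atTop_nhds_zero_nat (E 1)).const_add J
    exact (limsup_le_limsup hle).trans hlim.limsup_eq.le
  refine ⟨πs, J, V, fun s => ⟨⟨⟨πs s, ?_⟩, ?_⟩, ?_⟩, fun s₀ => ?_⟩
  · simp only [hsum]
    exact (hf s).symm
  · rintro _ ⟨a, rfl⟩
    simp only [hsum]
    exact (hV s).1 a a.2
  · rw [hsum]
    exact hf s
  · have heq := le_antisymm (lower s₀ (stationaryPolicy πs)) (upper s₀)
    refine ⟨heq, ⟨stationaryPolicy πs, heq.symm⟩, ?_⟩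
    rintro _ ⟨π, rfl⟩
    exact lower s₀ π

end Sched

namespace Sched

variable {N : ℕ} {lam : ℝ} {c : NodeState N → SchedAction N → ℝ} {𝒜 : Set (SchedAction N)}

/-! ### Relative bounds when no packet ever arrives -/

/-- The next state when no packet arrives. -/
def tick (s : NodeState N) : NodeState N := next s fun _ => false

/-- With no arrivals both trajectories just age, whatever the actions. The actions optimal from `t`
can be copied from `s`, and the cost differences sum to at most `D / (1 - g)`. -/
lemma valueIter_le_add_of_lam_eq_zero (h𝒜 : 𝒜.Nonempty) {α g : ℝ} (hα : 0 ≤ α) (hα1 : α < 1)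
    (hg : 0 ≤ g) (hg1 : g < 1) (n : ℕ) {s t : NodeState N} {D : ℝ} (hD : 0 ≤ D)
    (h : ∀ k a, c (tick^[k] s) a ≤ c (tick^[k] t) a + D * g ^ k) :
    valueIter 0 c 𝒜 α n s ≤ valueIter 0 c 𝒜 α n t + D / (1 - g) := by
  have hg' : 0 < 1 - g := by linarith
  induction n generalizing s t D with
  | zero => simp only [valueIter]; positivity
  | succ n ih =>
    obtain ⟨a, ha, ha'⟩ := exists_valueIter_succ_eq (lam := 0) (c := c) (α := α) h𝒜 n t
    have h1 := valueIter_succ_le (lam := 0) (c := c) (α := α) ha n s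
    rw [stepMean_zero] at ha' h1
    have h2 : valueIter 0 c 𝒜 α n (tick s) ≤ valueIter 0 c 𝒜 α n (tick t) + D * g / (1 - g) :=
      ih (mul_nonneg hD hg) fun k a => by
        have := h (k + 1) a
        simp only [Function.iterate_succ_apply] at this
        rwa [pow_succ', ← mul_assoc] at this
    have h0 := h 0 a
    simp only [Function.iterate_zero, id, pow_zero, mul_one] at h0
    have h3 := mul_le_mul_of_nonneg_left h2 hα
    have h4 : α * (D * g / (1 - g)) ≤ D * g / (1 - g) :=
      mul_le_of_le_one_left (by positivity) hα1.le
    have h5 : D / (1 - g) = D + D * g / (1 - g) := by field_simp; ring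
    rw [ha', h5]
    change _ ≤ _ + α * valueIter 0 c 𝒜 α n (tick t) + _
    change _ ≤ _ + α * valueIter 0 c 𝒜 α n (tick s) at h1
    rw [mul_add] at h3
    linarith

lemma valueIter_le_of_bounded (hc : IsMonotoneCost lam c) (h𝒜 : 𝒜.Nonempty) {α C : ℝ}
    (hα : 0 ≤ α) (hα1 : α < 1) (hC : ∀ s a, c s a ≤ C) (n : ℕ) (s : NodeState N) :
    valueIter lam c 𝒜 α n s ≤ C / (1 - α) := by
  have hα' : 0 < 1 - α := by linarith
  obtain ⟨a, ha⟩ := h𝒜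
  have hC0 : 0 ≤ C := (hc.nonneg s a).trans (hC s a)
  induction n generalizing s with
  | zero => simp only [valueIter]; positivity
  | succ n ih =>
    refine (valueIter_succ_le ha n s).trans ?_
    have h1 := stepMean_mono hc.lam_nonneg hc.lam_le_one a ih s
    rw [stepMean_const] at h1
    have h2 := mul_le_mul_of_nonneg_left h1 hα
    have h3 : C / (1 - α) = C + α * (C / (1 - α)) := by field_simp; ring
    linarith [hC s a]

theorem hasRelativeBound_of_lam_eq_zero (hc : IsMonotoneCost 0 c) (h𝒜 : 𝒜.Nonempty) {g C : ℝ}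
    (hg : 0 ≤ g) (hg1 : g < 1) (hC : ∀ s a, c s a ≤ C)
    (hD : ∀ s : NodeState N, ∃ D, 0 ≤ D ∧
      ∀ k a, c (tick^[k] s) a ≤ c (tick^[k] fun _ => 1) a + D * g ^ k) :
    HasRelativeBound 0 c 𝒜 := by
  have hb : ∀ α : ℝ, 1 / 2 ≤ α → α < 1 → ∀ s,
      BddAbove (Set.range fun n => valueIter 0 c 𝒜 α n s) := by
    intro α hα hα1 s
    refine ⟨C / (1 - α), ?_⟩
    rintro _ ⟨n, rfl⟩
    exact valueIter_le_of_bounded hc h𝒜 (by linarith) hα1 hC n s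
  refine ⟨hb, ⟨C, fun α hα hα1 => ?_⟩, ?_⟩
  · have hα' : 0 < 1 - α := by linarith
    rw [← le_div_iff₀' hα']
    exact ciSup_le fun n => valueIter_le_of_bounded hc h𝒜 (by linarith) hα1 hC n _
  · choose D hD0 hD using hD
    refine ⟨fun s => D s / (1 - g), fun α hα hα1 s => ciSup_le fun n => ?_⟩
    refine (valueIter_le_add_of_lam_eq_zero h𝒜 (by linarith) hα1 hg hg1 n (hD0 s)
      (hD s)).trans ?_
    exact add_le_add_left (valueIter_le_discValue (hb α hα hα1 _) n) _

/-! ### Relative bounds when packets arrive with positive probability -/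

/-- The exponential Lyapunov function of the ages. -/
def expAge (γ : ℝ) (s : NodeState N) : ℝ := ∑ i, γ ^ (s i : ℕ)

lemma expAge_nonneg {γ : ℝ} (hγ : 1 ≤ γ) (s : NodeState N) : 0 ≤ expAge γ s :=
  Finset.sum_nonneg fun _ _ => by positivity

lemma stepMean_expAge_le {γ : ℝ} (h0 : 0 ≤ lam) (h1 : lam ≤ 1) (hγ : 1 ≤ γ)
    (a : SchedAction N) (s : NodeState N) :
    stepMean lam a (expAge γ) s ≤ γ * expAge γ s := by
  rw [← stepMean_const lam a (γ * expAge γ s) s]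
  refine Finset.sum_le_sum fun b _ =>
    mul_le_mul_of_nonneg_left ?_ (outcomeProb_nonneg h0 h1 _ _)
  unfold expAge
  rw [Finset.mul_sum]
  refine Finset.sum_le_sum fun i _ => ?_
  rw [← pow_succ']
  refine pow_le_pow_right₀ hγ ?_
  unfold next
  split_ifs <;> simp

/-- A sequence of actions that schedules every node at least `R` times contracts the Lyapunov
function up to a constant. -/
lemma iterMean_expAge_le {γ : ℝ} (h0 : 0 ≤ lam) (h1 : lam ≤ 1) (hγ : 1 ≤ γ)
    {l : List (SchedAction N)} {R : ℕ} (hl : ∀ i, R ≤ l.countP fun a => a i)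
    (s : NodeState N) :
    iterMean lam l (expAge γ) s ≤
      (1 - lam) ^ R * γ ^ l.length * expAge γ s + N * (l.length * γ ^ l.length) := by
  have h2 : iterMean lam l (expAge γ) s = ∑ i, iterMean lam l (fun s => γ ^ (s i : ℕ)) s :=
    iterMean_sum lam l Finset.univ (fun i s => γ ^ (s i : ℕ)) s
  have h3 : (N : ℝ) * (l.length * γ ^ l.length) = ∑ _i : Fin N, (l.length * γ ^ l.length : ℝ) := by
    simp
  rw [h2, h3, expAge, Finset.mul_sum, ← Finset.sum_add_distrib]
  refine Finset.sum_le_sum fun i _ => (iterMean_pow_le h0 h1 hγ l i s).trans ?_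
  have h4 : (1 - lam) ^ (l.countP fun a => a i) ≤ (1 - lam) ^ R :=
    pow_le_pow_of_le_one (by linarith) (by linarith) (hl i)
  gcongr

/-- Following a fixed sequence of actions is not better than value iteration. -/
lemma valueIter_add_length_le (hc : IsMonotoneCost lam c) {α γ K : ℝ} (hα : 0 ≤ α)
    (hα1 : α ≤ 1) (hγ : 1 ≤ γ) (hK0 : 0 ≤ K) (hK : ∀ s a, c s a ≤ K * expAge γ s)
    {l : List (SchedAction N)} (hl : ∀ a ∈ l, a ∈ 𝒜) (n : ℕ) (s : NodeState N) :
    valueIter lam c 𝒜 α (n + l.length) s ≤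
      K * (l.length * γ ^ l.length) * expAge γ s
        + α ^ l.length * iterMean lam l (valueIter lam c 𝒜 α n) s := by
  induction l generalizing s with
  | nil => simp [iterMean]
  | cons a l ih =>
    have hl' : ∀ a ∈ l, a ∈ 𝒜 := fun b hb => hl b (List.mem_cons_of_mem _ hb)
    have e1 := valueIter_succ_le (lam := lam) (c := c) (α := α) (hl a (by simp))
      (n + l.length) s
    have e2 := stepMean_mono hc.lam_nonneg hc.lam_le_one a (ih hl') s
    rw [stepMean_add, stepMean_const_mul, stepMean_const_mul] at e2
    have e3 := stepMean_expAge_le hc.lam_nonneg hc.lam_le_one hγ a s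
    set Λ := expAge γ s
    have hΛ : 0 ≤ Λ := expAge_nonneg hγ s
    set M := stepMean lam a (iterMean lam l (valueIter lam c 𝒜 α n)) s
    have hcoef : 0 ≤ K * (l.length * γ ^ l.length) := by positivity
    have e4 : stepMean lam a (valueIter lam c 𝒜 α (n + l.length)) s
        ≤ K * (l.length * γ ^ l.length) * (γ * Λ) + α ^ l.length * M :=
      e2.trans (add_le_add_left (mul_le_mul_of_nonneg_left e3 hcoef) _)
    have e5 := mul_le_mul_of_nonneg_left e4 hα
    have e6 : α * (K * (l.length * γ ^ l.length) * (γ * Λ))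
        ≤ K * (l.length * γ ^ l.length) * (γ * Λ) :=
      mul_le_of_le_one_left (by positivity) hα1
    -- Every stage cost of the block is estimated by the same power of `γ`, which gives the factor
    -- `l.length + 1`.
    have e7 : K * Λ ≤ K * γ ^ (l.length + 1) * Λ := by
      have : 1 ≤ γ ^ (l.length + 1) := one_le_pow₀ hγ
      have h8 : 0 ≤ K * Λ := by positivity
      nlinarith
    have e8 : c s a ≤ K * Λ := hK s a
    simp only [List.length_cons, iterMean, ← add_assoc]
    push_cast
    have e9 : K * ((l.length + 1 : ℝ) * γ ^ (l.length + 1)) * Λ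
        = K * (l.length * γ ^ l.length) * (γ * Λ) + K * γ ^ (l.length + 1) * Λ := by ring
    rw [e9, pow_succ' α]
    change _ ≤ _ + α * α ^ l.length * M
    linarith

/-- The value iteration is bounded along the multiples of `T` once a supersolution of the
`T`-step inequality is known. -/
lemma valueIter_le_of_supersolution (hc : IsMonotoneCost lam c) (h𝒜 : 𝒜.Nonempty) {α : ℝ}
    (hα : 0 ≤ α) {T : ℕ} (hT : 1 ≤ T) {Φ : NodeState N → ℝ} (hΦ : ∀ s, 0 ≤ Φ s)
    (hstep : ∀ n, (∀ s, valueIter lam c 𝒜 α n s ≤ Φ s) →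
      ∀ s, valueIter lam c 𝒜 α (n + T) s ≤ Φ s) (n : ℕ) (s : NodeState N) :
    valueIter lam c 𝒜 α n s ≤ Φ s := by
  have h : ∀ k s, valueIter lam c 𝒜 α (k * T) s ≤ Φ s := by
    intro k
    induction k with
    | zero => intro s; rw [Nat.zero_mul]; exact hΦ s
    | succ k ih => rw [Nat.succ_mul]; exact hstep _ ih
  exact (valueIter_monotone_nat hc h𝒜 hα s (Nat.le_mul_of_pos_right n hT)).trans (h n s)

/-- The parameters of a block of actions over which the Lyapunov function contracts. -/
structure BlockData (lam : ℝ) (c : NodeState N → SchedAction N → ℝ) (γ K x : ℝ) (R T : ℕ) :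
    Prop where
  cost : IsMonotoneCost lam c
  one_le : 1 ≤ γ
  K_nonneg : 0 ≤ K
  cost_le : ∀ s a, c s a ≤ K * expAge γ s
  T_pos : 1 ≤ T
  x_nonneg : 0 ≤ x
  contract : K * (T * γ ^ T) + x * ((1 - lam) ^ R * γ ^ T) ≤ x

/-- The function `x * expAge γ + y` is a supersolution over one block: `contract` pays for the block
cost, and `y` solves `x * b + α * y = y`, which pays for the additive drift constant `x * b`. -/
lemma BlockData.valueIter_le {γ K x α : ℝ} {R T : ℕ} (hB : BlockData lam c γ K x R T)
    (h𝒜 : 𝒜.Nonempty) (hα : 0 ≤ α) (hα1 : α < 1) {l : List (SchedAction N)}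
    (hl : ∀ a ∈ l, a ∈ 𝒜) (hlT : l.length = T) (hlR : ∀ i, R ≤ l.countP fun a => a i) (n : ℕ)
    (s : NodeState N) :
    valueIter lam c 𝒜 α n s
      ≤ x * expAge γ s + x * (N * (T * γ ^ T)) / (1 - α) := by
  have hγ := hB.one_le
  have hx := hB.x_nonneg
  have hα' : 0 < 1 - α := by linarith
  set b : ℝ := N * (T * γ ^ T) with hb
  have hb0 : 0 ≤ b := by positivity
  set y := x * b / (1 - α) with hy
  have hy0 : 0 ≤ y := by positivity
  have hyeq : x * b + α * y = y := by rw [hy]; field_simp; ring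
  refine valueIter_le_of_supersolution hB.cost h𝒜 hα hB.T_pos
    (Φ := fun s => x * expAge γ s + y)
    (fun s => add_nonneg (mul_nonneg hx (expAge_nonneg hγ s)) hy0) (fun n hn s => ?_) n s
  have e1 := valueIter_add_length_le hB.cost hα hα1.le hγ hB.K_nonneg hB.cost_le hl n s
  have e2 := iterMean_mono hB.cost.lam_nonneg hB.cost.lam_le_one l hn s
  rw [iterMean_add, iterMean_const_mul, iterMean_const] at e2
  have e3 := iterMean_expAge_le hB.cost.lam_nonneg hB.cost.lam_le_one hγ hlR s
  rw [hlT] at e1 e3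
  set Λ := expAge γ s
  have hΛ : 0 ≤ Λ := expAge_nonneg hγ s
  set θ := (1 - lam) ^ R * γ ^ T with hθ
  have hθ0 : 0 ≤ θ := mul_nonneg (pow_nonneg (by linarith [hB.cost.lam_le_one]) _) (by positivity)
  have e4 := e2.trans (add_le_add_left (mul_le_mul_of_nonneg_left e3 hx) y)
  have e5 := mul_le_mul_of_nonneg_left e4 (pow_nonneg hα T)
  have hαT : α ^ T ≤ α := by
    simpa using pow_le_pow_of_le_one hα hα1.le hB.T_pos
  have e6 : α ^ T * (x * θ * Λ) ≤ x * θ * Λ :=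
    mul_le_of_le_one_left (by positivity) (hαT.trans hα1.le)
  have e7 : α ^ T * (x * b) ≤ x * b :=
    mul_le_of_le_one_left (by positivity) (hαT.trans hα1.le)
  have e8 : α ^ T * y ≤ α * y := mul_le_mul_of_nonneg_right hαT hy0
  have e9 := mul_le_mul_of_nonneg_right hB.contract hΛ
  have e10 : α ^ T * (x * (θ * Λ + b) + y)
      = α ^ T * (x * θ * Λ) + α ^ T * (x * b) + α ^ T * y := by ring
  rw [e10] at e5
  change _ ≤ x * Λ + y
  have e11 : (K * (T * γ ^ T) + x * θ) * Λ = K * (T * γ ^ T) * Λ + x * θ * Λ := by ring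
  rw [e11] at e9
  linarith

/-- If the block leads from every state to `w` when all packets arrive, then the discounted values
relative to `w` are bounded uniformly in the discount factor. -/
lemma BlockData.valueIter_le_add {γ K x α : ℝ} {R T : ℕ} (hB : BlockData lam c γ K x R T)
    (h𝒜 : 𝒜.Nonempty) (hlam : 0 < lam) (hα : 0 ≤ α) (hα1 : α < 1)
    (hbdd : ∀ s, BddAbove (Set.range fun n => valueIter lam c 𝒜 α n s))
    {l : List (SchedAction N)} (hl : ∀ a ∈ l, a ∈ 𝒜) (hlT : l.length = T)
    (hlR : ∀ i, R ≤ l.countP fun a => a i) {w : NodeState N} (hw : ∀ s, iterNext s l = w) (n : ℕ)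
    (s : NodeState N) :
    valueIter lam c 𝒜 α n s ≤ x * expAge γ s + x * (N * (T * γ ^ T)) / (lam ^ N) ^ T
      + discValue lam c 𝒜 α w := by
  classical
  have hγ := hB.one_le
  have hx := hB.x_nonneg
  set b : ℝ := N * (T * γ ^ T) with hb
  have hb0 : 0 ≤ b := by positivity
  have hδ : 0 < (lam ^ N) ^ T := by positivity
  set y := x * b / (lam ^ N) ^ T with hy
  have hy0 : 0 ≤ y := by positivity
  -- The constant `y` is such that its expected saving, on hitting `w` with probability at least
  -- `(lam ^ N) ^ T`, pays for the drift constant `x * b`.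
  have hyeq : y * (lam ^ N) ^ T = x * b := by rw [hy]; field_simp
  set v := discValue lam c 𝒜 α w with hv
  have hv0 : 0 ≤ v := discValue_nonneg (hbdd w)
  refine valueIter_le_of_supersolution hB.cost h𝒜 hα hB.T_pos
    (Φ := fun s => x * expAge γ s + y + v)
    (fun s => by
      have := mul_nonneg hx (expAge_nonneg hγ s)
      linarith) (fun n hn s => ?_) n s
  -- At `w` itself the value is at most `v`, so there the bound can be lowered by `y`.
  have hn' : ∀ s, valueIter lam c 𝒜 α n s
      ≤ (x * expAge γ s + (-y) * (if s = w then 1 else 0)) + (y + v) := by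
    intro s
    by_cases hs : s = w
    · have h1 : valueIter lam c 𝒜 α n s ≤ v := by
        rw [hs]; exact valueIter_le_discValue (hbdd w) n
      have := mul_nonneg hx (expAge_nonneg hγ s)
      simp only [hs, if_true] at this h1 ⊢
      linarith
    · have := hn s
      simp only [hs, if_false]
      linarith
  have e1 := valueIter_add_length_le hB.cost hα hα1.le hγ hB.K_nonneg hB.cost_le hl n s
  have e2 := iterMean_mono hB.cost.lam_nonneg hB.cost.lam_le_one l hn' s
  rw [iterMean_add, iterMean_add, iterMean_const_mul, iterMean_const_mul, iterMean_const] at e2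
  have e3 := iterMean_expAge_le hB.cost.lam_nonneg hB.cost.lam_le_one hγ hlR s
  have e12 := pow_mul_apply_iterNext_le_iterMean hB.cost.lam_nonneg hB.cost.lam_le_one l
    (f := fun s => if s = w then 1 else 0) (fun s => by positivity) s
  simp only [hw s, if_true, mul_one] at e12
  rw [hlT] at e1 e3 e12
  set Λ := expAge γ s
  have hΛ : 0 ≤ Λ := expAge_nonneg hγ s
  set θ := (1 - lam) ^ R * γ ^ T with hθ
  have hθ0 : 0 ≤ θ := mul_nonneg (pow_nonneg (by linarith [hB.cost.lam_le_one]) _) (by positivity)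
  have e4 : iterMean lam l (valueIter lam c 𝒜 α n) s ≤ x * θ * Λ + y + v := by
    have h1 := mul_le_mul_of_nonneg_left e3 hx
    have h2 := mul_le_mul_of_nonneg_left e12 hy0
    linarith
  have e5 := mul_le_mul_of_nonneg_left e4 (pow_nonneg hα T)
  have e6 : α ^ T * (x * θ * Λ + y + v) ≤ x * θ * Λ + y + v :=
    mul_le_of_le_one_left (by positivity) (pow_le_one₀ hα hα1.le)
  have e9 := mul_le_mul_of_nonneg_right hB.contract hΛ
  change _ ≤ x * Λ + y + v
  have e11 : (K * (T * γ ^ T) + x * θ) * Λ = K * (T * γ ^ T) * Λ + x * θ * Λ := by ring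
  rw [e11] at e9
  linarith

/-! ### A common state reachable from everywhere -/

/-- Among `k` consecutive blocks of actions, either every block but the last schedules a node that
no later block schedules, or some block schedules only nodes that are scheduled later. -/
lemma exists_redundant_block (r : ℕ) (k : ℕ) (l : List (SchedAction N)) (hl : l.length = k * r) :
    (∃ X Y D : List (SchedAction N), ∃ j < k, l = X ++ (Y ++ D) ∧ Y.length = r ∧
      D.length = j * r ∧ ∀ i : Fin N, (∃ a ∈ Y, a i = true) → ∃ a ∈ D, a i = true) ∨
    k ≤ (Finset.univ.filter fun i : Fin N => ∃ a ∈ l, a i = true).card := by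
  induction k generalizing l with
  | zero => right; simp
  | succ k ih =>
    have hsplit : l = l.take r ++ l.drop r := (List.take_append_drop r l).symm
    have hdrop : (l.drop r).length = k * r := by
      rw [List.length_drop, hl, Nat.succ_mul]; omega
    have htake : (l.take r).length = r := by
      rw [List.length_take, hl, Nat.succ_mul]; omega
    rcases ih _ hdrop with ⟨X, Y, D, j, hj, h1, h2, h3, h4⟩ | h
    · exact Or.inl ⟨l.take r ++ X, Y, D, j, by omega,
        by rw [List.append_assoc, ← h1, ← hsplit], h2, h3, h4⟩
    · by_cases hs : ∀ i : Fin N, (∃ a ∈ l.take r, a i = true) → ∃ a ∈ l.drop r, a i = true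
      · exact Or.inl ⟨[], l.take r, l.drop r, k, by omega, by simp, htake, hdrop, hs⟩
      -- The first block schedules a node that no later one does, so the set of scheduled nodes
      -- strictly grows. With `N + 1` blocks this alternative cannot hold.
      · right
        push Not at hs
        obtain ⟨i, ⟨a, ha, hai⟩, hi⟩ := hs
        refine lt_of_le_of_lt h (Finset.card_lt_card ?_)
        rw [Finset.ssubset_iff_of_subset]
        · refine ⟨i, ?_, ?_⟩
          · simp only [Finset.mem_filter, Finset.mem_univ, true_and]
            exact ⟨a, List.mem_of_mem_take ha, hai⟩
          · simp only [Finset.mem_filter, Finset.mem_univ, true_and]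
            rintro ⟨b, hb, hbi⟩
            exact hi b hb hbi
        · intro j hj
          simp only [Finset.mem_filter, Finset.mem_univ, true_and] at hj ⊢
          obtain ⟨b, hb, hbj⟩ := hj
          exact ⟨b, List.mem_of_mem_drop hb, hbj⟩

lemma le_countP_flatten_replicate {L : List (SchedAction N)} {i : Fin N}
    (hL : ∃ a ∈ L, a i = true) (m : ℕ) :
    m ≤ (List.replicate m L).flatten.countP fun a => a i := by
  induction m with
  | zero => simp
  | succ m ih =>
    have h1 : 0 < L.countP fun a => a i := by
      rw [List.countP_pos_iff]
      exact hL
    rw [List.replicate_succ, List.flatten_cons, List.countP_append]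
    omega

/-- From every state one can reach, with all packets arriving, a common state that is at most the
one reached by a given long sequence of actions. -/
lemma exists_dominating_block {r R : ℕ} {L : List (SchedAction N)} (hLr : L.length = r)
    (hL𝒜 : ∀ a ∈ L, a ∈ 𝒜) (hL : ∀ i, ∃ a ∈ L, a i = true) {l₀ : List (SchedAction N)}
    (hl₀ : l₀.length = (N + 1) * r) (hl₀𝒜 : ∀ a ∈ l₀, a ∈ 𝒜) (s₀ : NodeState N) :
    ∃ l : List (SchedAction N), ∃ w : NodeState N, (∀ a ∈ l, a ∈ 𝒜) ∧
      l.length = (R + N + 1) * r ∧ (∀ i, R ≤ l.countP fun a => a i) ∧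
      (∀ s, iterNext s l = w) ∧ w ≤ iterNext s₀ l₀ := by
  rcases exists_redundant_block r (N + 1) l₀ hl₀ with ⟨X, Y, D, j, hj, h1, h2, h3, h4⟩ | h
  swap
  · have := h.trans (Finset.card_filter_le _ _)
    simp at this
  -- The number of copies of `L` compensates for the position of the redundant block, so that the
  -- total length is always `(R + N + 1) * r`. It is at least `R` since `j ≤ N`.
  set m := R + N - j with hm
  set E := (List.replicate m L).flatten with hE
  have hcov : ∀ i, ∃ a ∈ E ++ (L ++ D), a i = true := fun i => by
    obtain ⟨a, ha, hai⟩ := hL i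
    exact ⟨a, by simp [ha], hai⟩
  refine ⟨E ++ (L ++ D), iterNext s₀ (E ++ (L ++ D)), ?_, ?_, ?_, ?_, ?_⟩
  · intro a ha
    rcases List.mem_append.1 ha with ha | ha
    · obtain ⟨L', hL', ha'⟩ := List.mem_flatten.1 ha
      rw [List.eq_of_mem_replicate hL'] at ha'
      exact hL𝒜 a ha'
    · rcases List.mem_append.1 ha with ha | ha
      · exact hL𝒜 a ha
      · exact hl₀𝒜 a (by rw [h1]; simp [ha])
  · simp only [List.length_append, hE, List.length_flatten, List.map_replicate,
      List.sum_replicate, hLr, h3, smul_eq_mul]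
    rw [show R + N + 1 = m + 1 + j by omega]
    ring
  · intro i
    have h5 : m ≤ E.countP fun a => a i := le_countP_flatten_replicate (hL i) m
    have h6 : 0 < L.countP fun a => a i := by
      rw [List.countP_pos_iff]
      exact hL i
    rw [List.countP_append, List.countP_append]
    omega
  · intro s
    funext i
    exact iterNext_apply_eq (hcov i) _ _
  · intro i
    rw [h1, iterNext_append, iterNext_append, iterNext_append, iterNext_append]
    -- Nodes scheduled in `D` forget what came before. The other nodes are not scheduled in `Y`
    -- either, so in the given sequence they are at least `r` old when `D` starts, whereas after the
    -- covering list `L` they are at most `r` old.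
    by_cases hi : ∃ a ∈ D, a i = true
    · exact (iterNext_apply_eq hi _ _).le
    · have hD : ∀ a ∈ D, a i = false := fun a ha => by
        by_contra hc
        exact hi ⟨a, ha, by simpa using hc⟩
      have hY : ∀ a ∈ Y, a i = false := fun a ha => by
        by_contra hc
        exact hi (h4 i ⟨a, ha, by simpa using hc⟩)
      rw [← PNat.coe_le_coe, iterNext_apply_of_forall hD, iterNext_apply_of_forall hD,
        iterNext_apply_of_forall hY, h2]
      have := iterNext_apply_le_length (hL i) (iterNext s₀ E)
      omega

/-- The relative bound under the drift condition `(1 - λ) γ ^ r < 1`, when every node can be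
scheduled within `r` consecutive steps. -/
theorem hasRelativeBound_of_lam_pos (hc : IsMonotoneCost lam c) (hlam : 0 < lam) {γ K : ℝ}
    (hγ : 1 ≤ γ) (hK0 : 0 ≤ K) (hK : ∀ s a, c s a ≤ K * expAge γ s) (h𝒜 : 𝒜.Nonempty)
    {L : List (SchedAction N)} (hL0 : 1 ≤ L.length)
    (hL𝒜 : ∀ a ∈ L, a ∈ 𝒜) (hL : ∀ i, ∃ a ∈ L, a i = true)
    (hdrift : (1 - lam) * γ ^ L.length < 1) :
    HasRelativeBound lam c 𝒜 := by
  set r := L.length with hr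
  have hγ0 : 0 < γ := by linarith
  have hlam1 : 0 ≤ 1 - lam := by linarith [hc.lam_le_one]
  -- The `N + 1` extra blocks may cost a factor `γ ^ ((N + 1) * r)`; `R` is large enough for the
  -- contraction to beat it.
  obtain ⟨R, hR⟩ : ∃ R : ℕ, ((1 - lam) * γ ^ r) ^ R < 1 / γ ^ ((N + 1) * r) :=
    exists_pow_lt_of_lt_one (by positivity) hdrift
  set T := (R + N + 1) * r with hT
  have hT1 : 1 ≤ T := Nat.mul_pos (by omega) hL0
  set θ := (1 - lam) ^ R * γ ^ T with hθ
  have hθ1 : θ < 1 := by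
    rw [lt_div_iff₀ (by positivity)] at hR
    refine lt_of_eq_of_lt ?_ hR
    rw [hθ, hT, mul_pow, ← pow_mul, mul_assoc, ← pow_add]
    congr 2
    ring
  have hθ' : 0 < 1 - θ := by linarith
  -- The solution of `K * (T * γ ^ T) + x * θ = x`.
  set x := K * (T * γ ^ T) / (1 - θ) with hx
  have hx0 : 0 ≤ x := by positivity
  have hB : BlockData lam c γ K x R T :=
    ⟨hc, hγ, hK0, hK, hT1, hx0, by
      have : x * (1 - θ) = K * (T * γ ^ T) := by rw [hx]; field_simp
      linarith⟩
  set b : ℝ := N * (T * γ ^ T) with hb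
  have hb0 : 0 ≤ b := by positivity
  have hval : ∀ α : ℝ, 0 ≤ α → α < 1 → ∀ n s,
      valueIter lam c 𝒜 α n s ≤ x * expAge γ s + x * b / (1 - α) := by
    intro α hα hα1
    refine hB.valueIter_le h𝒜 hα hα1 (l := (List.replicate (R + N + 1) L).flatten) ?_ ?_ ?_
    · intro a ha
      obtain ⟨L', hL', ha'⟩ := List.mem_flatten.1 ha
      rw [List.eq_of_mem_replicate hL'] at ha'
      exact hL𝒜 a ha'
    · simp [List.length_flatten, List.map_replicate, List.sum_replicate, hT, hr]
    · intro i
      have := le_countP_flatten_replicate (hL i) (R + N + 1)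
      omega
  have hbdd : ∀ α : ℝ, 1 / 2 ≤ α → α < 1 → ∀ s,
      BddAbove (Set.range fun n => valueIter lam c 𝒜 α n s) := by
    intro α hα hα1 s
    refine ⟨x * expAge γ s + x * b / (1 - α), ?_⟩
    rintro _ ⟨n, rfl⟩
    exact hval α (by linarith) hα1 n s
  set one : NodeState N := fun _ => 1 with hone
  set G := x * expAge γ one + x * b with hG
  have hgain : ∀ α : ℝ, 1 / 2 ≤ α → α < 1 → (1 - α) * discValue lam c 𝒜 α one ≤ G := by
    intro α hα hα1
    have hα' : 0 < 1 - α := by linarith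
    have h1 : discValue lam c 𝒜 α one ≤ x * expAge γ one + x * b / (1 - α) :=
      ciSup_le fun n => hval α (by linarith) hα1 n one
    have h2 := mul_le_mul_of_nonneg_left h1 hα'.le
    rw [mul_add, mul_div_cancel₀ _ hα'.ne'] at h2
    have h3 : (1 - α) * (x * expAge γ one) ≤ x * expAge γ one :=
      mul_le_of_le_one_left (mul_nonneg hx0 (expAge_nonneg hγ _)) (by linarith)
    linarith
  refine ⟨hbdd, ⟨G, hgain⟩, ?_⟩
  set H := (N + 1) * r with hH
  -- The last term bounds `V_α(w) - V_α(1)`, which is at most `(1 - α ^ H) * v₀`: Bernoulli gives `1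
  -- - α ^ H ≤ H * (1 - α)`, the condition `α ≥ 1 / 2` gives `v₀ ≤ 2 ^ H * v₁`, and `(1 - α) * v₁ ≤
  -- G`.
  refine ⟨fun s => x * expAge γ s + x * b / (lam ^ N) ^ T + H * 2 ^ H * G,
    fun α hα hα1 s => ?_⟩
  have hα0 : 0 ≤ α := by linarith
  have hbd := hbdd α hα hα1
  obtain ⟨l₀, hl₀, hl₀𝒜, hle⟩ := exists_list_pow_mul_discValue_le hc h𝒜 hα0 hbd H one
  obtain ⟨l, w, hl𝒜, hlT, hlR, hw, hwle⟩ :=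
    exists_dominating_block (R := R) hr.symm hL𝒜 hL hl₀ hl₀𝒜 one
  have h1 : discValue lam c 𝒜 α s ≤ x * expAge γ s + x * b / (lam ^ N) ^ T
      + discValue lam c 𝒜 α w :=
    ciSup_le fun n => hB.valueIter_le_add h𝒜 hlam hα0 hα1 hbd hl𝒜 hlT hlR hw n s
  have h2 : discValue lam c 𝒜 α w ≤ discValue lam c 𝒜 α (iterNext one l₀) :=
    discValue_monotone hc h𝒜 hα0 hbd hwle
  set v₀ := discValue lam c 𝒜 α (iterNext one l₀) with hv₀
  set v₁ := discValue lam c 𝒜 α one with hv₁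
  have hv₀0 : 0 ≤ v₀ := discValue_nonneg (hbd _)
  have hpow : (1 / 2 : ℝ) ^ H ≤ α ^ H := pow_le_pow_left₀ (by norm_num) hα H
  have h3 : v₀ ≤ 2 ^ H * v₁ := by
    have h4 := (mul_le_mul_of_nonneg_right hpow hv₀0).trans hle
    rw [one_div, inv_pow, inv_mul_le_iff₀ (by positivity)] at h4
    exact h4
  have hbern : 1 - α ^ H ≤ H * (1 - α) := by
    have := one_add_mul_le_pow (a := α - 1) (by linarith) H
    rw [add_sub_cancel] at this
    linarith
  have h5 : (1 - α ^ H) * v₀ ≤ H * 2 ^ H * G := by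
    calc (1 - α ^ H) * v₀ ≤ H * (1 - α) * v₀ := mul_le_mul_of_nonneg_right hbern hv₀0
      _ ≤ H * (1 - α) * (2 ^ H * v₁) :=
          mul_le_mul_of_nonneg_left h3 (mul_nonneg (by positivity) (by linarith))
      _ = H * 2 ^ H * ((1 - α) * v₁) := by ring
      _ ≤ H * 2 ^ H * G := mul_le_mul_of_nonneg_left (hgain α hα hα1) (by positivity)
  linarith

end Sched

namespace Network

open scoped MatrixOrder

variable {N n p : ℕ} (net : Network N n p)

/-! ### Loewner order estimates for the prediction maps -/

lemma conj_transpose_mono {X Y : Matrix (Fin n) (Fin n) ℝ} (h : X ≤ Y)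
    (A : Matrix (Fin n) (Fin n) ℝ) : A * X * A.transpose ≤ A * Y * A.transpose := by
  rw [Matrix.le_iff] at h ⊢
  have := h.mul_mul_conjTranspose_same A
  rwa [Matrix.conjTranspose_eq_transpose_of_trivial, Matrix.mul_sub, Matrix.sub_mul] at this

lemma conj_transpose_nonneg {X : Matrix (Fin n) (Fin n) ℝ} (h : 0 ≤ X)
    (A : Matrix (Fin n) (Fin n) ℝ) : 0 ≤ A * X * A.transpose := by
  simpa using conj_transpose_mono h A

lemma trace_le_trace {X Y : Matrix (Fin n) (Fin n) ℝ} (h : X ≤ Y) : X.trace ≤ Y.trace := by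
  have := (Matrix.le_iff.1 h).trace_nonneg
  rw [Matrix.trace_sub] at this
  linarith

lemma smul_mono_matrix {X Y : Matrix (Fin n) (Fin n) ℝ} (h : X ≤ Y) {x : ℝ} (hx : 0 ≤ x) :
    x • X ≤ x • Y := by
  rw [Matrix.le_iff] at h ⊢
  rw [← smul_sub]
  exact h.smul hx

lemma predict_mono {Y Z : Fin N → Matrix (Fin n) (Fin n) ℝ} (h : ∀ j, Y j ≤ Z j) (i : Fin N) :
    net.predict i Y ≤ net.predict i Z := by
  unfold predict
  gcongr
  · exact conj_transpose_mono (h i) _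
  · exact conj_transpose_mono (h _) _

lemma predict_posDef {Y : Fin N → Matrix (Fin n) (Fin n) ℝ} (h : ∀ j, 0 ≤ Y j) (i : Fin N) :
    (net.predict i Y).PosDef := by
  have h1 : (0 : Matrix (Fin n) (Fin n) ℝ) ≤ net.tildeA * Y i * net.tildeA.transpose
      + (net.deg i : ℝ) • ∑ j ∈ net.nbrs i, net.tildeG * Y j * net.tildeG.transpose := by
    refine add_nonneg (conj_transpose_nonneg (h i) _) ?_
    have := smul_mono_matrix (Finset.sum_nonneg fun j (_ : j ∈ net.nbrs i) =>
      conj_transpose_nonneg (h j) net.tildeG) (Nat.cast_nonneg (α := ℝ) (net.deg i))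
    simpa using this
  unfold predict
  rw [add_comm]
  exact (net.Q_posDef i).add_posSemidef (Matrix.nonneg_iff_posSemidef.1 h1)

/-- A measurement does not increase the performance index. -/
lemma inv_inv_add_le {X S : Matrix (Fin n) (Fin n) ℝ} (hX : X.PosDef) (hS : S.PosSemidef) :
    (X⁻¹ + S)⁻¹ ≤ X := by
  set Z := X⁻¹ + S with hZdef
  have hZ : Z.PosDef := hX.inv.add_posSemidef hS
  have hZu : IsUnit Z.det := (Matrix.isUnit_iff_isUnit_det _).1 hZ.isUnit
  have hXu : IsUnit X.det := (Matrix.isUnit_iff_isUnit_det _).1 hX.isUnit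
  have hT : (S + S * X * S).PosSemidef := by
    refine hS.add ?_
    have := hX.posSemidef.mul_mul_conjTranspose_same S
    rwa [hS.isHermitian.eq] at this
  -- Conjugating `X - Z⁻¹` by `Z` removes the inverse and leaves a visibly positive semidefinite
  -- matrix.
  have h1 : Z * X * Z - Z = S + S * X * S := by
    rw [hZdef]
    simp only [add_mul, mul_add, Matrix.nonsing_inv_mul X hXu, one_mul]
    rw [Matrix.mul_assoc S X X⁻¹, Matrix.mul_nonsing_inv X hXu, mul_one]
    abel
  have h2 : X - Z⁻¹ = Z⁻¹ * (S + S * X * S) * Z⁻¹ := by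
    rw [← h1, mul_sub, sub_mul, ← Matrix.mul_assoc, ← Matrix.mul_assoc,
      Matrix.nonsing_inv_mul Z hZu, one_mul, one_mul, Matrix.mul_assoc,
      Matrix.mul_nonsing_inv Z hZu, mul_one]
  rw [Matrix.le_iff, h2]
  have := hT.mul_mul_conjTranspose_same Z⁻¹
  rwa [hZ.inv.isHermitian.eq] at this

/-! ### Monotonicity of the cost in the ages -/

section SteadyState

variable {net} {P : Fin N → Matrix (Fin n) (Fin n) ℝ}

lemma IsSteadyState.nonneg (hP : net.IsSteadyState P) (i : Fin N) : 0 ≤ P i :=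
  Matrix.nonneg_iff_posSemidef.2 (hP i).1

/-- The steady state is the prediction corrected by a measurement, whose information `Cᵀ R⁻¹ C` is
positive semidefinite. -/
lemma IsSteadyState.le_predict (hP : net.IsSteadyState P) (i : Fin N) :
    P i ≤ net.predict i P := by
  conv_lhs => rw [(hP i).2]
  refine inv_inv_add_le (net.predict_posDef hP.nonneg i) ?_
  have := (net.R_posDef i).inv.posSemidef.mul_mul_conjTranspose_same net.C.transpose
  rwa [Matrix.conjTranspose_eq_transpose_of_trivial, Matrix.transpose_transpose] at this

lemma IsSteadyState.le_updatedIndex (hP : net.IsSteadyState P) (s : NodeState N) (t : ℕ)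
    (i : Fin N) : P i ≤ net.updatedIndex P s t i := by
  induction t generalizing i with
  | zero => exact le_rfl
  | succ t ih =>
    simp only [updatedIndex]
    split_ifs
    · exact le_rfl
    · exact (hP.le_predict i).trans (net.predict_mono ih i)

/-- Older information gives larger performance indices. -/
lemma IsSteadyState.updatedIndex_mono (hP : net.IsSteadyState P) {s s' : NodeState N}
    (h : s ≤ s') {d : ℕ} (hd : maxAge s' = maxAge s + d) (t : ℕ) (i : Fin N) :
    net.updatedIndex P s t i ≤ net.updatedIndex P s' (t + d) i := by
  induction t generalizing i with
  | zero => exact hP.le_updatedIndex s' _ i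
  | succ t ih =>
    rw [show t + 1 + d = t + d + 1 by ring]
    have hi : (s i : ℕ) ≤ s' i := h i
    simp only [updatedIndex]
    -- The shift `d` aligns the two recursions at the current time. Since `s ≤ s'`, a node still at
    -- `P i` under `s'` is so under `s`, which excludes the third case.
    split_ifs with h1 h2 h2
    · exact le_rfl
    · exact (hP.le_predict i).trans (net.predict_mono (hP.le_updatedIndex s' _) i)
    · omega
    · exact net.predict_mono ih i

lemma maxAge_mono {s s' : NodeState N} (h : s ≤ s') : maxAge s ≤ maxAge s' :=
  Finset.sup_mono_fun fun i _ => h i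

lemma one_le_maxAge (hN : 0 < N) (s : NodeState N) : 1 ≤ maxAge s :=
  (s ⟨0, hN⟩).pos.trans_le
    (Finset.le_sup (f := fun i => (s i : ℕ)) (Finset.mem_univ (⟨0, hN⟩ : Fin N)))

/-- The part of the one-stage cost that does not depend on the action. -/
noncomputable def predTrace (net : Network N n p) (P : Fin N → Matrix (Fin n) (Fin n) ℝ)
    (s : NodeState N) : ℝ :=
  ∑ i, (net.predict i (net.updatedIndex P s (maxAge s - 1))).trace

lemma IsSteadyState.predTrace_mono (hN : 0 < N) (hP : net.IsSteadyState P) :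
    Monotone (net.predTrace P) := by
  intro s s' h
  obtain ⟨d, hd⟩ := Nat.exists_eq_add_of_le (maxAge_mono h)
  have h1 := one_le_maxAge hN s
  refine Finset.sum_le_sum fun i _ => trace_le_trace (net.predict_mono (fun j => ?_) i)
  rw [show maxAge s' - 1 = maxAge s - 1 + d by omega]
  exact hP.updatedIndex_mono h hd _ j

lemma IsSteadyState.predTrace_nonneg (hP : net.IsSteadyState P) (s : NodeState N) :
    0 ≤ net.predTrace P s :=
  Finset.sum_nonneg fun i _ => (net.predict_posDef
    (fun j => (hP.nonneg j).trans (hP.le_updatedIndex s _ j)) i).posSemidef.trace_nonneg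

lemma cost_eq (s : NodeState N) (a : SchedAction N) :
    net.cost P s a = net.predTrace P s + net.κ * numScheduled a := by
  unfold cost predTrace numScheduled
  rw [Finset.sum_add_distrib, ← Finset.mul_sum]
  simp

lemma IsSteadyState.isMonotoneCost (hN : 0 < N) (hP : net.IsSteadyState P) :
    Sched.IsMonotoneCost net.lam (net.cost P) where
  lam_nonneg := net.lam_nonneg
  lam_le_one := net.lam_le_one
  nonneg s a := by
    rw [cost_eq]
    have := hP.predTrace_nonneg s
    have := net.κ_pos
    positivity
  mono a s t h := by
    simp only [cost_eq]
    exact add_le_add_left (hP.predTrace_mono hN h) _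

/-- At equal ages all nodes leave the steady state at once, so the recursion is plain iteration of
the prediction maps. -/
lemma updatedIndex_const (hN : 0 < N) (m : ℕ+) (t : ℕ) :
    net.updatedIndex P (fun _ => m) t = (fun Y i => net.predict i Y)^[t] P := by
  have hm : maxAge (fun _ : Fin N => m) = m :=
    le_antisymm (Finset.sup_le fun _ _ => le_rfl)
      (Finset.le_sup (f := fun _ : Fin N => (m : ℕ)) (Finset.mem_univ ⟨0, hN⟩))
  induction t with
  | zero => rfl
  | succ t ih =>
    rw [Function.iterate_succ_apply', ← ih]
    funext i
    simp [updatedIndex, hm]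

lemma predTrace_const (hN : 0 < N) (m : ℕ) :
    net.predTrace P (fun _ => m.succPNat)
      = ∑ i, ((fun Y i => net.predict i Y)^[m + 1] P i).trace := by
  have hm : maxAge (fun _ : Fin N => m.succPNat) = m + 1 :=
    le_antisymm (Finset.sup_le fun _ _ => le_rfl)
      (Finset.le_sup (f := fun _ : Fin N => (m.succPNat : ℕ)) (Finset.mem_univ ⟨0, hN⟩))
  unfold predTrace
  rw [hm, Function.iterate_succ_apply', Nat.add_sub_cancel, updatedIndex_const hN]

end SteadyState

/-! ### The growth rate of the cost -/

/-- The linear map that bounds the growth of a common upper bound of the indices of all nodes. -/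
noncomputable def boundMap (E : Matrix (Fin n) (Fin n) ℝ) : Matrix (Fin n) (Fin n) ℝ :=
  net.tildeA * E * net.tildeA.transpose
    + (net.maxDeg : ℝ) ^ 2 • (net.tildeG * E * net.tildeG.transpose)

lemma boundMap_nonneg {E : Matrix (Fin n) (Fin n) ℝ} (hE : 0 ≤ E) : 0 ≤ net.boundMap E := by
  refine add_nonneg (conj_transpose_nonneg hE _) ?_
  simpa using smul_mono_matrix (conj_transpose_nonneg hE net.tildeG) (sq_nonneg (net.maxDeg : ℝ))

/-- The prediction is affine, and a common increment `E` enters its sum `deg i` times with the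
factor `deg i`; hence the square, at most `maxDeg ^ 2`. -/
lemma predict_le_add_boundMap {Y Z : Fin N → Matrix (Fin n) (Fin n) ℝ}
    {E : Matrix (Fin n) (Fin n) ℝ} (hE : 0 ≤ E) (h : ∀ j, Y j ≤ Z j + E) (i : Fin N) :
    net.predict i Y ≤ net.predict i Z + net.boundMap E := by
  refine (net.predict_mono h i).trans ?_
  have h1 : net.predict i (fun j => Z j + E) = net.predict i Z
      + (net.tildeA * E * net.tildeA.transpose
        + (net.deg i : ℝ) ^ 2 • (net.tildeG * E * net.tildeG.transpose)) := by
    unfold predict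
    simp only [mul_add, add_mul, Finset.sum_add_distrib, Finset.sum_const, smul_add]
    rw [show (net.nbrs i).card = net.deg i from rfl, ← Nat.cast_smul_eq_nsmul ℝ, smul_smul, ← sq]
    abel
  rw [h1]
  refine add_le_add le_rfl (add_le_add le_rfl ?_)
  have hd : (net.deg i : ℝ) ^ 2 ≤ (net.maxDeg : ℝ) ^ 2 := by
    have : net.deg i ≤ net.maxDeg := Finset.le_sup (Finset.mem_univ i)
    gcongr
  have h2 := smul_mono_matrix (conj_transpose_nonneg hE net.tildeG) (sub_nonneg.2 hd)
  rw [smul_zero, sub_smul] at h2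
  exact sub_nonneg.1 h2

/-- The matrix `Ãᵀ Ã + d_m² G̃ᵀ G̃` of the feasibility condition. -/
noncomputable def growthMatrix : Matrix (Fin n) (Fin n) ℝ :=
  net.tildeA.transpose * net.tildeA
    + (net.maxDeg : ℝ) ^ 2 • (net.tildeG.transpose * net.tildeG)

lemma growthMatrix_nonneg : 0 ≤ net.growthMatrix := by
  have h : ∀ X : Matrix (Fin n) (Fin n) ℝ, 0 ≤ X.transpose * X := fun X => by
    rw [Matrix.nonneg_iff_posSemidef]
    simpa using Matrix.posSemidef_conjTranspose_mul_self X
  refine add_nonneg (h _) ?_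
  simpa using smul_mono_matrix (h net.tildeG) (sq_nonneg (net.maxDeg : ℝ))

lemma trace_boundMap (E : Matrix (Fin n) (Fin n) ℝ) :
    (net.boundMap E).trace = (net.growthMatrix * E).trace := by
  unfold boundMap growthMatrix
  rw [add_mul, Matrix.trace_add, Matrix.trace_add, Matrix.smul_mul, Matrix.trace_smul,
    Matrix.trace_smul, Matrix.trace_mul_comm, Matrix.trace_mul_comm (net.tildeG * E),
    Matrix.mul_assoc, Matrix.mul_assoc]

/-- By cyclicity the trace of `W * X` is that of `√X W √X`, which is monotone in `W`. -/
lemma trace_mul_le {W X : Matrix (Fin n) (Fin n) ℝ} {g : ℝ} (hW : W ≤ g • 1) (hX : 0 ≤ X) :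
    (W * X).trace ≤ g * X.trace := by
  have h1 := trace_le_trace (conj_transpose_mono hW (CFC.sqrt X))
  have hsymm : (CFC.sqrt X).transpose = CFC.sqrt X := by
    have := (Matrix.nonneg_iff_posSemidef.1 (CFC.sqrt_nonneg X)).isHermitian.eq
    rwa [Matrix.conjTranspose_eq_transpose_of_trivial] at this
  rw [hsymm, Matrix.mul_assoc, Matrix.trace_mul_comm, Matrix.mul_assoc,
    CFC.sqrt_mul_sqrt_self X hX] at h1
  simpa [CFC.sqrt_mul_sqrt_self X hX] using h1

open scoped Matrix.Norms.L2Operator in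
/-- A symmetric matrix is bounded by its spectral radius. -/
lemma mul_self_le_realSpectralRadius {U : Matrix (Fin n) (Fin n) ℝ} (hU : U.IsHermitian) :
    U * U ≤ realSpectralRadius U ^ 2 • (1 : Matrix (Fin n) (Fin n) ℝ) := by
  set Uc : Matrix (Fin n) (Fin n) ℂ := U.map ((↑) : ℝ → ℂ) with hUc
  have hUcH : Uc.IsHermitian := by
    ext i j
    have := congrFun (congrFun hU.eq i) j
    simp only [Matrix.conjTranspose_apply, star_trivial] at this
    simp [hUc, this]
  -- For a self-adjoint complex matrix the spectral radius is the operator norm, so the claim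
  -- becomes the norm bound for real vectors viewed as complex ones.
  have hρ : realSpectralRadius U = ‖Uc‖ := by
    unfold realSpectralRadius
    rw [IsSelfAdjoint.spectralRadius_eq_nnnorm (show IsSelfAdjoint Uc from hUcH)]
    rfl
  have hUt : U.transpose = U := by
    have := hU.eq
    rwa [Matrix.conjTranspose_eq_transpose_of_trivial] at this
  rw [Matrix.le_iff]
  refine Matrix.PosSemidef.of_dotProduct_mulVec_nonneg ?_ fun x => ?_
  · rw [Matrix.IsHermitian, Matrix.conjTranspose_eq_transpose_of_trivial]
    simp [Matrix.transpose_mul, hUt]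
  · have hx := Matrix.l2_opNorm_mulVec Uc (WithLp.toLp 2 fun i => (x i : ℂ))
    have hmul : Uc.mulVec (fun i => (x i : ℂ)) = fun i => ((U.mulVec x i : ℝ) : ℂ) := by
      funext i
      simp [hUc, Matrix.mulVec, dotProduct]
    have h2 := pow_le_pow_left₀ (norm_nonneg _) hx 2
    rw [mul_pow, ← hρ] at h2
    simp only [hmul, EuclideanSpace.norm_sq_eq] at h2
    have h3 : ∑ i, (U.mulVec x i) ^ 2 ≤ realSpectralRadius U ^ 2 * ∑ i, x i ^ 2 := by
      simpa using h2
    have h4 : x ⬝ᵥ (U * U).mulVec x = ∑ i, (U.mulVec x i) ^ 2 := by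
      rw [← Matrix.mulVec_mulVec, Matrix.dotProduct_mulVec, ← Matrix.mulVec_transpose, hUt]
      simp [dotProduct, sq]
    have h5 : x ⬝ᵥ x = ∑ i, x i ^ 2 := by simp [dotProduct, sq]
    rw [star_trivial, Matrix.sub_mulVec, dotProduct_sub, Matrix.smul_mulVec, Matrix.one_mulVec,
      dotProduct_smul, h4, h5, smul_eq_mul]
    linarith

/-- The feasibility condition bounds the growth rate of the trace of a common upper bound. -/
lemma FeasibilityCondition.exists_rate {M : ℕ} (h : net.FeasibilityCondition M) :
    ∃ g : ℝ, 0 ≤ g ∧ (1 - net.lam) * g ^ ⌈(N : ℚ) / (M : ℚ)⌉₊ < 1 ∧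
      ∀ E, 0 ≤ E → (net.boundMap E).trace ≤ g * E.trace := by
  -- Among the factors allowed by the condition, the symmetric one has its spectral radius equal to
  -- its norm.
  set U := CFC.sqrt net.growthMatrix with hU
  have hUH : U.IsHermitian := (Matrix.nonneg_iff_posSemidef.1 (CFC.sqrt_nonneg _)).isHermitian
  have hUU : U * U = net.growthMatrix :=
    CFC.sqrt_mul_sqrt_self _ net.growthMatrix_nonneg
  have hUt : U.transpose = U := by
    have := hUH.eq
    rwa [Matrix.conjTranspose_eq_transpose_of_trivial] at this
  refine ⟨realSpectralRadius U ^ 2, sq_nonneg _, ?_, fun E hE => ?_⟩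
  · rw [← pow_mul]
    exact h U (by rw [hUt, hUU]; rfl)
  · rw [trace_boundMap, ← hUU]
    exact trace_mul_le (mul_self_le_realSpectralRadius hUH) hE

/-- The cost at equal ages grows at most geometrically with the age. -/
lemma IsSteadyState.exists_growth {net : Network N n p}
    {P : Fin N → Matrix (Fin n) (Fin n) ℝ} (hN : 0 < N) (hP : net.IsSteadyState P) {g : ℝ}
    (hg : 0 ≤ g) (hE : ∀ E, 0 ≤ E → (net.boundMap E).trace ≤ g * E.trace) :
    ∃ D : ℝ, 0 ≤ D ∧ ∀ m : ℕ, net.predTrace P (fun _ => (m + 1).succPNat)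
      ≤ net.predTrace P (fun _ => m.succPNat) + D * g ^ m := by
  set H : (Fin N → Matrix (Fin n) (Fin n) ℝ) → Fin N → Matrix (Fin n) (Fin n) ℝ :=
    fun Y i => net.predict i Y with hH
  -- The sum of the first increments is one matrix that dominates the increment of every node, and
  -- `boundMap` propagates this domination.
  set E : ℕ → Matrix (Fin n) (Fin n) ℝ :=
    fun m => net.boundMap^[m] (∑ i, (net.predict i P - P i)) with hEdef
  have hE0 : ∀ m, 0 ≤ E m := by
    intro m
    induction m with
    | zero => exact Finset.sum_nonneg fun i _ => sub_nonneg.2 (hP.le_predict i)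
    | succ m ih =>
      simp only [hEdef, Function.iterate_succ_apply']
      exact net.boundMap_nonneg ih
  have hstep : ∀ m i, H^[m + 1] P i ≤ H^[m] P i + E m := by
    intro m
    induction m with
    | zero =>
      intro i
      have h1 : net.predict i P - P i ≤ ∑ i, (net.predict i P - P i) :=
        Finset.single_le_sum (f := fun i => net.predict i P - P i)
          (fun i _ => sub_nonneg.2 (hP.le_predict i)) (Finset.mem_univ i)
      have h2 := sub_le_iff_le_add'.1 h1
      exact h2
    | succ m ih =>
      intro i
      have e1 : H^[m + 1 + 1] P i = net.predict i (H^[m + 1] P) :=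
        congrFun (Function.iterate_succ_apply' H (m + 1) P) i
      have e2 : H^[m + 1] P i = net.predict i (H^[m] P) :=
        congrFun (Function.iterate_succ_apply' H m P) i
      have e3 : E (m + 1) = net.boundMap (E m) := Function.iterate_succ_apply' _ m _
      rw [e1, e2, e3]
      exact net.predict_le_add_boundMap (hE0 m) ih i
  have htr : ∀ m, (E (m + 1)).trace ≤ g * (E 0).trace * g ^ m := by
    intro m
    induction m with
    | zero =>
      have h1 : (E 1).trace ≤ g * (E 0).trace := hE _ (hE0 0)
      simpa using h1
    | succ m ih =>
      have h1 : (E (m + 1 + 1)).trace ≤ g * (E (m + 1)).trace := by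
        have := hE _ (hE0 (m + 1))
        simp only [hEdef] at this ⊢
        rwa [Function.iterate_succ_apply' _ (m + 1)]
      calc _ ≤ g * (E (m + 1)).trace := h1
        _ ≤ g * (g * (E 0).trace * g ^ m) := mul_le_mul_of_nonneg_left ih hg
        _ = _ := by ring
  have hE00 : 0 ≤ (E 0).trace := (Matrix.nonneg_iff_posSemidef.1 (hE0 0)).trace_nonneg
  refine ⟨N * (g * (E 0).trace), by positivity, fun m => ?_⟩
  rw [predTrace_const hN, predTrace_const hN]
  have h3 : (N : ℝ) * (g * (E 0).trace) * g ^ m = ∑ _i : Fin N, g * (E 0).trace * g ^ m := by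
    simp [mul_assoc]
  rw [h3, ← Finset.sum_add_distrib]
  refine Finset.sum_le_sum fun i _ => ?_
  have h4 := trace_le_trace (hstep (m + 1) i)
  rw [Matrix.trace_add] at h4
  exact h4.trans (by gcongr; exact htr m)

end Network

/-! ### Covering schedules and verification of the relative bounds -/

namespace Sched

variable {N n p : ℕ}

/-- A family of `⌈N / M⌉` actions with `M` transmissions each that covers all nodes. -/
lemma exists_covering_list {M : ℕ} (hM : 1 ≤ M) (hMN : M ≤ N) :
    ∃ L : List (SchedAction N), L.length = ⌈(N : ℚ) / (M : ℚ)⌉₊ ∧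
      (∀ a ∈ L, numScheduled a = M) ∧ ∀ i, ∃ a ∈ L, a i = true := by
  classical
  -- The nodes with quotient `k` by `M` number at most `M`, being separated by their remainders; the
  -- set is padded to exactly `M` nodes, as the last block may be incomplete.
  have hblock : ∀ k : ℕ, ∃ t : Finset (Fin N),
      (Finset.univ.filter fun i : Fin N => (i : ℕ) / M = k) ⊆ t ∧ t.card = M := by
    intro k
    refine Finset.exists_superset_card_eq ?_ (by simpa using hMN)
    refine (Finset.card_le_card_of_injOn (t := Finset.range M) (fun i : Fin N => (i : ℕ) % M)
      (fun i _ => by simpa using Nat.mod_lt _ hM) ?_).trans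
      (Finset.card_range M).le
    intro i hi j hj hij
    simp only [Finset.coe_filter, Finset.mem_univ, true_and, Set.mem_ofPred_eq] at hi hj
    apply Fin.ext
    rw [← Nat.div_add_mod (i : ℕ) M, ← Nat.div_add_mod (j : ℕ) M, hi, hj]
    simp only at hij
    rw [hij]
  choose t ht htM using hblock
  refine ⟨(List.range ⌈(N : ℚ) / (M : ℚ)⌉₊).map fun k i => decide (i ∈ t k), by simp, ?_, ?_⟩
  · intro a ha
    obtain ⟨k, -, rfl⟩ := List.mem_map.1 ha
    rw [← htM k]
    unfold numScheduled
    congr 1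
    ext i
    simp
  · intro i
    refine ⟨fun j => decide (j ∈ t ((i : ℕ) / M)), List.mem_map.2 ⟨(i : ℕ) / M, ?_, rfl⟩, ?_⟩
    · rw [List.mem_range]
      have hM' : (0 : ℚ) < M := by exact_mod_cast hM
      have h1 : (((i : ℕ) / M : ℕ) : ℚ) ≤ (i : ℕ) / M := Nat.cast_div_le
      have h2 : ((i : ℕ) : ℚ) / M < N / M := by
        have : ((i : ℕ) : ℚ) < N := by exact_mod_cast i.2
        gcongr
      exact_mod_cast (h1.trans_lt h2).trans_le (Nat.le_ceil _)
    · simpa using ht _ (by simp)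

lemma tick_iterate_apply (s : NodeState N) (k : ℕ) (i : Fin N) :
    ((tick^[k] s) i : ℕ) = s i + k := by
  induction k generalizing s with
  | zero => rfl
  | succ k ih =>
    rw [Function.iterate_succ_apply, ih]
    simp [tick, next]
    ring

lemma exists_le_const (hN : 0 < N) (s : NodeState N) :
    ∃ (m : ℕ) (i : Fin N), (s i : ℕ) = m + 1 ∧ s ≤ fun _ => m.succPNat := by
  have : Nonempty (Fin N) := ⟨⟨0, hN⟩⟩
  obtain ⟨i, hi⟩ := Finite.exists_max s
  have := (s i).pos
  refine ⟨(s i : ℕ) - 1, i, by omega, fun j => ?_⟩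
  rw [← PNat.coe_le_coe]
  have h1 : (s j : ℕ) ≤ s i := hi j
  simp only [Nat.succPNat_coe]
  omega

lemma numScheduled_le (a : SchedAction N) : numScheduled a ≤ N :=
  (Finset.card_filter_le _ _).trans (by simp)

/-- The Lyapunov function needs `γ ≥ 1`, and comparison with a geometric series needs strictness.
Both fit since the condition holds at `max g 1` and is open. -/
lemma exists_gt_drift {x g : ℝ} (hx : x < 1) (r : ℕ) (hg : x * g ^ r < 1) :
    ∃ γ : ℝ, 1 < γ ∧ g ≤ γ ∧ x * γ ^ r < 1 := by
  have h1 : x * max g 1 ^ r < 1 := by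
    rcases max_choice g 1 with h | h <;> rw [h]
    · exact hg
    · simpa using hx
  have hcont : Tendsto (fun γ : ℝ => x * γ ^ r) (𝓝[>] (max g 1)) (𝓝 (x * max g 1 ^ r)) :=
    ((continuous_const.mul (continuous_pow r)).tendsto _).mono_left nhdsWithin_le_nhds
  obtain ⟨γ, hγ1, hγ2⟩ := ((hcont.eventually_lt_const h1).and self_mem_nhdsWithin).exists
  have hγ2' : max g 1 < γ := hγ2
  exact ⟨γ, (le_max_right _ _).trans_lt hγ2', ((le_max_left _ _).trans_lt hγ2').le, hγ1⟩

/-- The feasibility condition makes the relative values of the discounted scheduling problems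
uniformly bounded. -/
theorem hasRelativeBound_of_feasibility (net : Network N n p) {M : ℕ} (hM : 1 ≤ M) (hMN : M ≤ N)
    {P : Fin N → Matrix (Fin n) (Fin n) ℝ} (hP : net.IsSteadyState P)
    {𝒜 : Set (SchedAction N)} (h𝒜 : {a : SchedAction N | numScheduled a = M} ⊆ 𝒜)
    (hne : 𝒜.Nonempty) (hfeas : net.FeasibilityCondition M) :
    HasRelativeBound net.lam (net.cost P) 𝒜 := by
  have hN : 0 < N := by omega
  obtain ⟨g, hg, hdrift, hE⟩ := Network.FeasibilityCondition.exists_rate net hfeas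
  obtain ⟨D, hD, hgrow⟩ := hP.exists_growth hN hg hE
  have hc := hP.isMonotoneCost hN
  have hκ := net.κ_pos
  have hcost : ∀ s a, net.cost P s a ≤ net.predTrace P s + net.κ * N := fun s a => by
    rw [Network.cost_eq]
    have : (numScheduled a : ℝ) ≤ N := by exact_mod_cast numScheduled_le a
    gcongr
  set f : ℕ → ℝ := fun m => net.predTrace P (fun _ => m.succPNat) with hf
  have hf0 : 0 ≤ f 0 := hP.predTrace_nonneg _
  obtain ⟨L, hLlen, hLM, hLcov⟩ := exists_covering_list hM hMN
  have hr : 1 ≤ L.length := by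
    obtain ⟨a, ha, -⟩ := hLcov ⟨0, hN⟩
    exact List.length_pos_of_mem ha
  rw [← hLlen] at hdrift
  rcases net.lam_nonneg.eq_or_lt with hlam | hlam
  -- Without arrivals the drift condition reads `g ^ r < 1`, so the cost increments are summable and
  -- the cost is bounded.
  · rw [← hlam] at hdrift hc ⊢
    have hg1 : g < 1 := by
      by_contra hge
      have := one_le_pow₀ (n := L.length) (not_lt.1 hge)
      linarith
    have hg1' : 0 < 1 - g := by linarith
    -- The difference is a sum of `m` increments, each at most `D * g ^ k`.
    have hshift : ∀ m k, f (m + k) ≤ f k + D * m * g ^ k := by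
      intro m k
      induction m with
      | zero => simp
      | succ m ih =>
        have h1 := hgrow (m + k)
        have h2 : D * g ^ (m + k) ≤ D * g ^ k :=
          mul_le_mul_of_nonneg_left (pow_le_pow_of_le_one hg hg1.le (by omega)) hD
        rw [show m + 1 + k = m + k + 1 by ring]
        change f (m + k + 1) ≤ f (m + k) + _ at h1
        push_cast
        linarith
    have hbound : ∀ m, f m ≤ f 0 + D / (1 - g) * (1 - g ^ m) := by
      intro m
      induction m with
      | zero => simp
      | succ m ih =>
        have h1 : f (m + 1) ≤ f m + D * g ^ m := hgrow m
        have h2 : D / (1 - g) * (1 - g ^ (m + 1)) = D / (1 - g) * (1 - g ^ m) + D * g ^ m := by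
          field_simp; ring
        rw [h2]
        linarith
    refine hasRelativeBound_of_lam_eq_zero (C := f 0 + D / (1 - g) + net.κ * N) hc hne hg hg1
      (fun s a => (hcost s a).trans ?_) fun s => ?_
    · obtain ⟨m, -, -, hs⟩ := exists_le_const hN s
      have h1 : net.predTrace P s ≤ f m := hP.predTrace_mono hN hs
      have h2 := hbound m
      have h3 : D / (1 - g) * (1 - g ^ m) ≤ D / (1 - g) :=
        mul_le_of_le_one_right (by positivity) (by linarith [pow_nonneg hg m])
      linarith
    · obtain ⟨m, -, -, hs⟩ := exists_le_const hN s
      refine ⟨D * m, by positivity, fun k a => ?_⟩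
      have h1 : net.predTrace P (tick^[k] s) ≤ f (m + k) := by
        refine hP.predTrace_mono hN fun i => ?_
        rw [← PNat.coe_le_coe, tick_iterate_apply]
        have : (s i : ℕ) ≤ m + 1 := hs i
        simp only [Nat.succPNat_coe]
        omega
      have h2 : (tick^[k] fun _ => 1 : NodeState N) = fun _ => k.succPNat := by
        funext i
        rw [← PNat.coe_inj, tick_iterate_apply]
        simp [add_comm]
      rw [Network.cost_eq, Network.cost_eq, h2]
      have h3 := hshift m k
      change _ ≤ f k + _ + _
      linarith
  · obtain ⟨γ, hγ1, hgγ, hγ⟩ := exists_gt_drift (x := 1 - net.lam) (by linarith) _ hdrift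
    have hγ' : 0 < γ - 1 := by linarith
    have hbound : ∀ m, f m ≤ f 0 + D / (γ - 1) * γ ^ m := by
      intro m
      induction m with
      | zero =>
        have : 0 ≤ D / (γ - 1) := by positivity
        simpa using this
      | succ m ih =>
        have h1 : f (m + 1) ≤ f m + D * g ^ m := hgrow m
        have h2 : D / (γ - 1) * γ ^ (m + 1) = D / (γ - 1) * γ ^ m + D * γ ^ m := by
          field_simp; ring
        have h3 : D * g ^ m ≤ D * γ ^ m := by gcongr
        rw [h2]
        linarith
    have hK0 : 0 ≤ f 0 + D / (γ - 1) + net.κ * N := by positivity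
    refine hasRelativeBound_of_lam_pos hc hlam hγ1.le hK0 (fun s a => (hcost s a).trans ?_) hne hr
      (fun a ha => h𝒜 (hLM a ha)) hLcov hγ
    obtain ⟨m, i, hi, hs⟩ := exists_le_const hN s
    have h1 : net.predTrace P s ≤ f m := hP.predTrace_mono hN hs
    have h2 := hbound m
    -- Some node attains the largest age `m + 1`, so its term alone suffices.
    have h3 : γ ^ (m + 1) ≤ expAge γ s := by
      rw [← hi]
      exact Finset.single_le_sum (f := fun i => γ ^ (s i : ℕ)) (fun _ _ => by positivity)
        (Finset.mem_univ i)
    have h4 : 1 ≤ γ ^ m := one_le_pow₀ hγ1.le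
    have h5 : γ ^ m ≤ γ ^ (m + 1) := pow_le_pow_right₀ hγ1.le (by omega)
    have h6 : 0 ≤ f 0 + net.κ * N := by positivity
    have h7 : f 0 + net.κ * N ≤ (f 0 + net.κ * N) * γ ^ m := le_mul_of_one_le_right h6 h4
    have h8 := mul_le_mul_of_nonneg_left (h5.trans h3) hK0
    have h9 : (f 0 + D / (γ - 1) + net.κ * N) * γ ^ m
        = (f 0 + net.κ * N) * γ ^ m + D / (γ - 1) * γ ^ m := by ring
    linarith

end Sched

theorem theorem2 {N n p : ℕ} (net : Network N n p) (M : ℕ) (hM : 1 ≤ M) (hMN : M ≤ N)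
    (P : Fin N → Matrix (Fin n) (Fin n) ℝ) (hP : net.IsSteadyState P)
    (𝒜 : Set (SchedAction N)) (h𝒜 : {a : SchedAction N | numScheduled a = M} ⊆ 𝒜)
    (hfeas : net.FeasibilityCondition M) :
    ∃ (πstar : NodeState N → 𝒜) (Jstar : ℝ) (V : NodeState N → ℝ),
      (∀ s : NodeState N,
        IsLeast
          (Set.range fun a : 𝒜 =>
            net.cost P s (a : SchedAction N)
              + ∑' s' : NodeState N, V s' * net.trans s' s (a : SchedAction N))
          (Jstar + V s) ∧
        Jstar + V s =
          net.cost P s (πstar s : SchedAction N)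
            + ∑' s' : NodeState N, V s' * net.trans s' s (πstar s : SchedAction N)) ∧
      (∀ s₀ : NodeState N,
        (Jstar : EReal) = net.avgCost P s₀ (stationaryPolicy πstar) ∧
        IsLeast (Set.range fun π : SchedPolicy 𝒜 => net.avgCost P s₀ π) (Jstar : EReal)) := by
  have hne : 𝒜.Nonempty := by
    obtain ⟨L, -, hLM, hLcov⟩ := Sched.exists_covering_list hM hMN
    obtain ⟨a, ha, -⟩ := hLcov ⟨0, by omega⟩
    exact ⟨a, h𝒜 (hLM a ha)⟩
  exact Sched.exists_optimal_stationary net P hne (hP.isMonotoneCost (by omega))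
    (Sched.hasRelativeBound_of_feasibility net hM hMN hP h𝒜 hne hfeas)
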